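/- **Proposition 3.1 (pullback).** Let $S$ be a complex normal affine surface, that is, an affine integral normal scheme of finite type over $\mathbb{C}$ of dimension $2$. Let $\mathbf{x}\in S$ be a closed regular point, and put $S_*:=S\setminus\{\mathbf{x}\}$. Let $\mathbb{A}^2_*$ be the affine plane over $\mathbb{C}$ without the origin. Let $\mathbb{G}_a$ act on $\mathrm{SL}_2$ by right multiplication with the upper triangular unipotent matrices, $A\cdot c=A\begin{pmatrix}1&c\\0&1\end{pmatrix}$, and regard $\mathrm{SL}_2$ as a $\mathbb{G}_a$-scheme over $\mathbb{A}^2_*$ by $A=(a_{ij})\mapsto(a_{11},a_{21})$. A principal $\mathbb{G}_a$-bundle over a scheme $X$ is an $X$-scheme with an action of $\mathbb{G}_a$ over $X$ which, Zariski locally on $X$, is $\mathbb{G}_a$-equivariantly isomorphic over $X$ to $X\times\mathbb{G}_a$ (with $\mathbb{G}_a$ acting by translation on the second factor); it is trivial if such an isomorphism exists over all of $X$. Let $\pi\colon P\to S_*$ be a nontrivial principal $\mathbb{G}_a$-bundle. Then there are an affine open neighbourhood $U\subset S$ of $\mathbf{x}$ and regular functions $g,h\in\mathcal{O}(U)$ with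 $\mathbf{x}$ as their only common zero in $U$, such that, with $U_*:=U\setminus\{\mathbf{x}\}$ and the morphism $\varphi:=(g,h)\colon U_*\to\mathbb{A}^2_*$, $$P|_{U_*}\;\simeq\;\varphi^*(\mathrm{SL}_2)=U_*\times_{\mathbb{A}^2_*}\mathrm{SL}_2$$ by a $\mathbb{G}_a$-equivariant isomorphism over $U_*$. -/

import Mathlib

open AlgebraicGeometry CategoryTheory CategoryTheory.Limits

noncomputable section

/-! ### Schemes with an action of the additive group over a base

For a scheme `T` the product `T × 𝔾ₐ` is the affine line `𝔸(Unit; T)`, and the `T`-points of the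
group scheme `𝔾ₐ` are the elements of the additive group `Γ(T, ⊤)`. -/

/-- The `T`-point `(p, c)` of `P × 𝔾ₐ`, for a `T`-point `p` of `P` and `c ∈ 𝔾ₐ(T) = Γ(T, ⊤)`. -/
def gaPoint {T P : Scheme.{0}} (p : T ⟶ P) (c : Γ(T, ⊤)) : T ⟶ 𝔸(Unit; P) :=
  AffineSpace.homOfVector p (fun _ => c)

/-- An `X`-scheme with a (right) action of the additive group `𝔾ₐ` that preserves the projection
to `X`. The action is a morphism `P × 𝔾ₐ ⟶ P`; the laws of an action are stated on `T`-points. -/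
structure GaScheme (X : Scheme.{0}) where
  /-- the total space `P` -/
  total : Scheme.{0}
  /-- the projection `π : P ⟶ X` -/
  proj : total ⟶ X
  /-- the action `P × 𝔾ₐ ⟶ P` -/
  act : 𝔸(Unit; total) ⟶ total
  act_proj : act ≫ proj = (𝔸(Unit; total) ↘ total) ≫ proj
  act_zero : ∀ (T : Scheme.{0}) (p : T ⟶ total), gaPoint p 0 ≫ act = p
  act_add : ∀ (T : Scheme.{0}) (p : T ⟶ total) (c d : Γ(T, ⊤)),
    gaPoint (gaPoint p c ≫ act) d ≫ act = gaPoint p (c + d) ≫ act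

lemma gaPoint_over {T P : Scheme.{0}} (p : T ⟶ P) (c : Γ(T, ⊤)) :
    gaPoint p c ≫ (𝔸(Unit; P) ↘ P) = p :=
  AffineSpace.homOfVector_over _ _

lemma gaPoint_coord {T P : Scheme.{0}} (p : T ⟶ P) (c : Γ(T, ⊤)) :
    (gaPoint p c).appTop (AffineSpace.coord P ()) = c :=
  AffineSpace.homOfVector_appTop_coord _ _ _

lemma comp_gaPoint {T T' P : Scheme.{0}} (e : T' ⟶ T) (p : T ⟶ P) (c : Γ(T, ⊤)) :
    e ≫ gaPoint p c = gaPoint (e ≫ p) (e.appTop c) :=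
  AffineSpace.comp_homOfVector _ _ _

lemma gaPoint_comp_over {T P Z : Scheme.{0}} (p : T ⟶ P) (c : Γ(T, ⊤)) (f : P ⟶ Z) :
    gaPoint p c ≫ (𝔸(Unit; P) ↘ P) ≫ f = p ≫ f := by
  rw [← Category.assoc, gaPoint_over]

lemma gaPoint_map {T P Q : Scheme.{0}} (p : T ⟶ P) (c : Γ(T, ⊤)) (f : P ⟶ Q) :
    gaPoint p c ≫ AffineSpace.map Unit f = gaPoint (p ≫ f) c := by
  apply AffineSpace.hom_ext
  · rw [Category.assoc, AffineSpace.map_over, ← Category.assoc, gaPoint_over, gaPoint_over]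
  · intro i
    rw [gaPoint_coord, Scheme.Hom.comp_appTop, CommRingCat.comp_apply,
      AffineSpace.map_appTop_coord, gaPoint_coord]

namespace GaScheme

variable {X Y : Scheme.{0}}

/-- Isomorphisms of schemes with `𝔾ₐ`-action over `X`: equivariant isomorphisms over `X`. -/
structure Iso (P Q : GaScheme X) where
  /-- the isomorphism of total spaces -/
  iso : P.total ≅ Q.total
  hom_proj : iso.hom ≫ Q.proj = P.proj
  equivariant : P.act ≫ iso.hom = AffineSpace.map Unit iso.hom ≫ Q.act

/-- The trivial bundle `X × 𝔾ₐ ⟶ X`, on which `𝔾ₐ` acts by translation on the second factor. -/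
def trivial (X : Scheme.{0}) : GaScheme X where
  total := 𝔸(Unit; X)
  proj := 𝔸(Unit; X) ↘ X
  act := gaPoint ((𝔸(Unit; 𝔸(Unit; X)) ↘ 𝔸(Unit; X)) ≫ (𝔸(Unit; X) ↘ X))
    ((𝔸(Unit; 𝔸(Unit; X)) ↘ 𝔸(Unit; X)).appTop (AffineSpace.coord X ()) +
      AffineSpace.coord 𝔸(Unit; X) ())
  act_proj := by rw [gaPoint_over]
  act_zero T p := by
    rw [comp_gaPoint, gaPoint_comp_over]
    apply AffineSpace.hom_ext
    · rw [gaPoint_over]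
    · intro i
      rw [gaPoint_coord, map_add, gaPoint_coord, ← CommRingCat.comp_apply,
        ← Scheme.Hom.comp_appTop, gaPoint_over, add_zero]
  act_add T p c d := by
    have key : ∀ (q : T ⟶ 𝔸(Unit; X)) (b : Γ(T, ⊤)),
        gaPoint q b ≫ gaPoint ((𝔸(Unit; 𝔸(Unit; X)) ↘ 𝔸(Unit; X)) ≫ (𝔸(Unit; X) ↘ X))
          ((𝔸(Unit; 𝔸(Unit; X)) ↘ 𝔸(Unit; X)).appTop (AffineSpace.coord X ()) +
            AffineSpace.coord 𝔸(Unit; X) ()) =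
        gaPoint (q ≫ (𝔸(Unit; X) ↘ X)) (q.appTop (AffineSpace.coord X ()) + b) := by
      intro q b
      rw [comp_gaPoint, gaPoint_comp_over, map_add, gaPoint_coord, ← CommRingCat.comp_apply,
        ← Scheme.Hom.comp_appTop, gaPoint_over]
    rw [key, key, key, gaPoint_over, gaPoint_coord, add_assoc]

/-- The pullback `f^*P = Y ×_X P` with the induced action of `𝔾ₐ` on the second factor. -/
def pullback (P : GaScheme X) (f : Y ⟶ X) : GaScheme Y where
  total := Limits.pullback f P.proj
  proj := Limits.pullback.fst f P.proj
  act := Limits.pullback.lift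
    ((𝔸(Unit; Limits.pullback f P.proj) ↘ Limits.pullback f P.proj) ≫
      Limits.pullback.fst f P.proj)
    (AffineSpace.map Unit (Limits.pullback.snd f P.proj) ≫ P.act)
    (by rw [Category.assoc, Category.assoc, P.act_proj, ← Category.assoc (AffineSpace.map _ _),
      AffineSpace.map_over, Category.assoc, Limits.pullback.condition])
  act_proj := Limits.pullback.lift_fst _ _ _
  act_zero T p := by
    apply Limits.pullback.hom_ext
    · rw [Category.assoc, Limits.pullback.lift_fst, ← Category.assoc, gaPoint_over]
    · rw [Category.assoc, Limits.pullback.lift_snd, ← Category.assoc, gaPoint_map, P.act_zero]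
  act_add T p c d := by
    apply Limits.pullback.hom_ext
    · simp only [Category.assoc, Limits.pullback.lift_fst]
      simp only [← Category.assoc, gaPoint_over]
      simp only [Category.assoc, Limits.pullback.lift_fst]
      simp only [← Category.assoc, gaPoint_over]
    · simp only [Category.assoc, Limits.pullback.lift_snd]
      simp only [← Category.assoc, gaPoint_map]
      simp only [Category.assoc, Limits.pullback.lift_snd]
      simp only [← Category.assoc, gaPoint_map]
      exact P.act_add _ _ _ _

/-- Being isomorphic to the trivial bundle `X × 𝔾ₐ`. -/
def IsTrivial (P : GaScheme X) : Prop :=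
  Nonempty (P.Iso (trivial X))

/-- A principal `𝔾ₐ`-bundle over `X`: a scheme with `𝔾ₐ`-action over `X` which is, locally on `X`
in the Zariski topology, equivariantly isomorphic to the trivial bundle. -/
def IsPrincipalBundle (P : GaScheme X) : Prop :=
  ∀ y : X, ∃ V : X.Opens, y ∈ V ∧ (P.pullback V.ι).IsTrivial

end GaScheme

/-! ### The punctured plane -/

/-- The field of complex numbers as a one-point scheme. -/
abbrev SpecC : Scheme.{0} := Spec (CommRingCat.of ℂ)

/-- The punctured complex affine plane `𝔸²_*`: the points of `𝔸²` at which at least one of the two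
coordinates does not vanish. -/
def puncturedPlane : (𝔸(Fin 2; SpecC)).Opens :=
  (𝔸(Fin 2; SpecC)).basicOpen (AffineSpace.coord SpecC 0) ⊔
    (𝔸(Fin 2; SpecC)).basicOpen (AffineSpace.coord SpecC 1)

/-- The morphism `(a, b) : T ⟶ 𝔸²_*` given by two functions `a`, `b` without common zeros on a
complex scheme `T`. -/
def toPuncturedPlane {T : Scheme.{0}} (t : T ⟶ SpecC) (a b : Γ(T, ⊤))
    (hab : T.basicOpen a ⊔ T.basicOpen b = ⊤) : T ⟶ puncturedPlane.toScheme :=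
  IsOpenImmersion.lift puncturedPlane.ι (AffineSpace.homOfVector t ![a, b]) (by
    rw [Scheme.Opens.range_ι]
    rintro _ ⟨y, rfl⟩
    have key : AffineSpace.homOfVector t ![a, b] ⁻¹ᵁ puncturedPlane = ⊤ := by
      rw [puncturedPlane, Scheme.Hom.preimage_sup, Scheme.preimage_basicOpen_top,
        Scheme.preimage_basicOpen_top, AffineSpace.homOfVector_appTop_coord,
        AffineSpace.homOfVector_appTop_coord]
      exact hab
    have hy : y ∈ AffineSpace.homOfVector t ![a, b] ⁻¹ᵁ puncturedPlane := by rw [key]; trivial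
    exact hy)

/-! ### The special linear group as a scheme over `𝔸²_*` -/

/-- The coordinate ring `ℂ[a₁₁, a₁₂, a₂₁, a₂₂] / (det - 1)` of `SL₂`. -/
abbrev SL2Ring : Type :=
  MvPolynomial (Fin 2 × Fin 2) ℂ ⧸
    Ideal.span {(Matrix.mvPolynomialX (Fin 2) (Fin 2) ℂ).det - 1}

/-- The complex variety `SL₂`. -/
abbrev SL2 : Scheme.{0} := Spec (CommRingCat.of SL2Ring)

namespace SL2

/-- The structure morphism of `SL₂`. -/
def toSpecC : SL2 ⟶ SpecC := Spec.map (CommRingCat.ofHom (algebraMap ℂ SL2Ring))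

/-- The universal matrix of determinant one. -/
def univMatrix : Matrix.SpecialLinearGroup (Fin 2) SL2Ring :=
  ⟨(Matrix.mvPolynomialX (Fin 2) (Fin 2) ℂ).map (Ideal.Quotient.mk _), by
    rw [← RingHom.mapMatrix_apply, ← RingHom.map_det, ← sub_eq_zero,
      ← (Ideal.Quotient.mk _).map_one, ← map_sub, Ideal.Quotient.eq_zero_iff_mem]
    exact Ideal.subset_span rfl⟩

/-- The matrix over `Γ(T, ⊤)` that corresponds to a `T`-point of `SL₂`. -/
def matrix {T : Scheme.{0}} (f : T ⟶ SL2) : Matrix.SpecialLinearGroup (Fin 2) Γ(T, ⊤) :=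
  Matrix.SpecialLinearGroup.map
    (((Scheme.ΓSpecIso (CommRingCat.of SL2Ring)).inv ≫ f.appTop).hom) univMatrix

/-- The `T`-point of `SL₂` that corresponds to a matrix over `Γ(T, ⊤)`, for a complex scheme `T`. -/
def ofMatrix {T : Scheme.{0}} (t : T ⟶ SpecC) (M : Matrix.SpecialLinearGroup (Fin 2) Γ(T, ⊤)) :
    T ⟶ SL2 :=
  T.toSpecΓ ≫ Spec.map (CommRingCat.ofHom (Ideal.Quotient.lift _
    (MvPolynomial.eval₂Hom ((Scheme.ΓSpecIso (CommRingCat.of ℂ)).inv ≫ t.appTop).hom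
      (fun p => M p.1 p.2)) (by
      intro a ha
      rw [← RingHom.mem_ker]
      revert a
      rw [← SetLike.le_def, Ideal.span_le, Set.singleton_subset_iff, SetLike.mem_coe,
        RingHom.mem_ker, map_sub, map_one, RingHom.map_det, sub_eq_zero]
      convert M.det_coe
      ext i j
      simp [Matrix.mvPolynomialX])))

lemma inv_appTop {T : Scheme.{0}} {R : CommRingCat.{0}} (f : R ⟶ Γ(T, ⊤)) :
    (Scheme.ΓSpecIso R).inv ≫ (T.toSpecΓ ≫ Spec.map f).appTop = f := by
  rw [Scheme.Hom.comp_appTop, Scheme.toSpecΓ_appTop, ← Category.assoc,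
    ← Scheme.ΓSpecIso_inv_naturality, Category.assoc, Iso.inv_hom_id, Category.comp_id]

lemma hom_ext_spec {T : Scheme.{0}} {R : CommRingCat.{0}} {f g : T ⟶ Spec R}
    (h : (Scheme.ΓSpecIso R).inv ≫ f.appTop = (Scheme.ΓSpecIso R).inv ≫ g.appTop) : f = g :=
  ext_of_isAffine ((cancel_epi _).mp h)

lemma ofMatrix_toSpecC {T : Scheme.{0}} (t : T ⟶ SpecC)
    (M : Matrix.SpecialLinearGroup (Fin 2) Γ(T, ⊤)) : ofMatrix t M ≫ toSpecC = t := by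
  apply hom_ext_spec
  rw [ofMatrix, toSpecC, Category.assoc, ← Spec.map_comp, inv_appTop]
  ext z
  exact MvPolynomial.eval₂_C _ _ z

lemma matrix_ofMatrix {T : Scheme.{0}} (t : T ⟶ SpecC)
    (M : Matrix.SpecialLinearGroup (Fin 2) Γ(T, ⊤)) : matrix (ofMatrix t M) = M := by
  rw [matrix, ofMatrix, inv_appTop]
  ext i j
  exact MvPolynomial.eval₂_X _ _ _

lemma matrix_comp {T T' : Scheme.{0}} (e : T' ⟶ T) (f : T ⟶ SL2) :
    matrix (e ≫ f) = Matrix.SpecialLinearGroup.map e.appTop.hom (matrix f) := by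
  ext i j
  rw [matrix, Scheme.Hom.comp_appTop]
  rfl

lemma hom_ext {T : Scheme.{0}} {f g : T ⟶ SL2} (h : f ≫ toSpecC = g ≫ toSpecC)
    (h' : matrix f = matrix g) : f = g := by
  apply hom_ext_spec
  apply CommRingCat.hom_ext
  apply Ideal.Quotient.ringHom_ext
  apply MvPolynomial.ringHom_ext
  · intro z
    have h1 := congrArg (fun q => (Scheme.ΓSpecIso (CommRingCat.of ℂ)).inv ≫ Scheme.Hom.appTop q) h
    simp only [toSpecC, Scheme.Hom.comp_appTop] at h1
    simp only [← Category.assoc, ← Scheme.ΓSpecIso_inv_naturality] at h1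
    exact congrArg (fun q => q.hom z) h1
  · intro p
    exact congrArg (fun M : Matrix.SpecialLinearGroup (Fin 2) Γ(T, ⊤) => M p.1 p.2) h'

/-- The embedding of `𝔾ₐ` in `SL₂` as the upper triangular unipotent matrices. -/
def unipotent {R : Type} [CommRing R] (c : R) : Matrix.SpecialLinearGroup (Fin 2) R :=
  ⟨!![1, c; 0, 1], by simp⟩

lemma unipotent_zero {R : Type} [CommRing R] : unipotent (0 : R) = 1 := by
  ext i j
  fin_cases i <;> fin_cases j <;> rfl

lemma unipotent_mul {R : Type} [CommRing R] (c d : R) :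
    unipotent c * unipotent d = unipotent (c + d) := by
  ext i j
  rw [Matrix.SpecialLinearGroup.coe_mul]
  fin_cases i <;> fin_cases j <;> simp [unipotent, Matrix.mul_apply, add_comm]

lemma map_unipotent {R R' : Type} [CommRing R] [CommRing R'] (f : R →+* R') (c : R) :
    Matrix.SpecialLinearGroup.map f (unipotent c) = unipotent (f c) := by
  ext i j
  rw [Matrix.SpecialLinearGroup.map_apply_coe, RingHom.mapMatrix_apply, Matrix.map_apply]
  fin_cases i <;> fin_cases j <;> simp [unipotent]

lemma mul_unipotent_apply_zero {R : Type} [CommRing R]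
    (M : Matrix.SpecialLinearGroup (Fin 2) R) (c : R) (i : Fin 2) :
    (M * unipotent c) i 0 = M i 0 := by
  rw [Matrix.SpecialLinearGroup.coe_mul, Matrix.mul_apply, Fin.sum_univ_two]
  simp [unipotent]

/-- The action of `𝔾ₐ` on `SL₂` by right multiplication: `(A, c) ↦ A * !![1, c; 0, 1]`. -/
def act : 𝔸(Unit; SL2) ⟶ SL2 :=
  ofMatrix ((𝔸(Unit; SL2) ↘ SL2) ≫ toSpecC)
    (matrix (𝔸(Unit; SL2) ↘ SL2) * unipotent (AffineSpace.coord SL2 ()))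

lemma gaPoint_act_toSpecC {T : Scheme.{0}} (p : T ⟶ SL2) (c : Γ(T, ⊤)) :
    (gaPoint p c ≫ act) ≫ toSpecC = p ≫ toSpecC := by
  rw [Category.assoc, act, ofMatrix_toSpecC, ← Category.assoc, gaPoint_over]

lemma matrix_gaPoint_act {T : Scheme.{0}} (p : T ⟶ SL2) (c : Γ(T, ⊤)) :
    matrix (gaPoint p c ≫ act) = matrix p * unipotent c := by
  rw [matrix_comp, act, matrix_ofMatrix, map_mul, map_unipotent, ← matrix_comp, gaPoint_over]
  congr 2
  exact gaPoint_coord p c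

lemma sup_basicOpen_eq_top {T : Scheme.{0}} (M : Matrix.SpecialLinearGroup (Fin 2) Γ(T, ⊤)) :
    T.basicOpen (M 0 0) ⊔ T.basicOpen (M 1 0) = ⊤ := by
  rw [eq_top_iff]
  intro y _
  by_contra hy
  have h0 : ¬ IsUnit (T.presheaf.germ ⊤ y trivial (M 0 0)) := fun h =>
    hy (Or.inl ((T.mem_basicOpen_top (M 0 0) y).mpr h))
  have h1 : ¬ IsUnit (T.presheaf.germ ⊤ y trivial (M 1 0)) := fun h =>
    hy (Or.inr ((T.mem_basicOpen_top (M 1 0) y).mpr h))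
  have hM : M 0 0 * M 1 1 - M 0 1 * M 1 0 = 1 := by
    rw [← Matrix.det_fin_two]
    exact M.det_coe
  have hM' := congrArg (T.presheaf.germ ⊤ y trivial) hM
  rw [map_sub, map_mul, map_mul, map_one] at hM'
  rw [← mem_nonunits_iff, ← IsLocalRing.mem_maximalIdeal] at h0 h1
  have h2 := Ideal.sub_mem _ (Ideal.mul_mem_right (T.presheaf.germ ⊤ y trivial (M 1 1)) _ h0)
    (Ideal.mul_mem_left _ (T.presheaf.germ ⊤ y trivial (M 0 1)) h1)
  rw [hM'] at h2
  exact (IsLocalRing.maximalIdeal.isMaximal _).ne_top ((Ideal.eq_top_iff_one _).mpr h2)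

/-- The morphism `SL₂ ⟶ 𝔸²_*`, `A ↦ (a₁₁, a₂₁)`. -/
def proj : SL2 ⟶ puncturedPlane.toScheme :=
  toPuncturedPlane toSpecC (matrix (𝟙 SL2) 0 0) (matrix (𝟙 SL2) 1 0) (sup_basicOpen_eq_top _)

lemma comp_proj_ι {T : Scheme.{0}} (p : T ⟶ SL2) :
    p ≫ proj ≫ puncturedPlane.ι =
      AffineSpace.homOfVector (p ≫ toSpecC) ![matrix p 0 0, matrix p 1 0] := by
  rw [proj, toPuncturedPlane, IsOpenImmersion.lift_fac, AffineSpace.comp_homOfVector]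
  congr 1
  have h := matrix_comp p (𝟙 SL2)
  rw [Category.comp_id] at h
  rw [h]
  funext i
  fin_cases i <;> rfl

/-- `SL₂` as a scheme with `𝔾ₐ`-action over `𝔸²_*`. -/
def bundle : GaScheme puncturedPlane.toScheme where
  total := SL2
  proj := proj
  act := act
  act_proj := by
    rw [← cancel_mono puncturedPlane.ι, Category.assoc, Category.assoc, comp_proj_ι, comp_proj_ι,
      act, ofMatrix_toSpecC, matrix_ofMatrix]
    congr 1
    funext i
    fin_cases i
    · exact mul_unipotent_apply_zero _ _ 0
    · exact mul_unipotent_apply_zero _ _ 1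
  act_zero T p := by
    apply hom_ext
    · rw [gaPoint_act_toSpecC]
    · rw [matrix_gaPoint_act, unipotent_zero, mul_one]
  act_add T p c d := by
    apply hom_ext
    · simp only [gaPoint_act_toSpecC]
    · simp only [matrix_gaPoint_act, mul_assoc, unipotent_mul]

end SL2

/-! ### Surfaces -/

/-- `S` is a complex normal affine surface: an affine integral scheme of finite type over `ℂ`
which is normal (all local rings are integrally closed domains) and of dimension two. -/
structure IsNormalAffineSurface {S : Scheme.{0}} (s : S ⟶ SpecC) : Prop where
  isAffine : IsAffine S
  isIntegral : IsIntegral S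
  locallyOfFiniteType : LocallyOfFiniteType s
  isIntegrallyClosed : ∀ y : S, IsIntegrallyClosed (S.presheaf.stalk y)
  dim_eq_two : topologicalKrullDim S = 2

/-- The punctured scheme `S_* = S \ {x}`, for a closed point `x` of `S`. -/
def puncture {S : Scheme.{0}} (x : S) (hx : IsClosed {x}) : S.Opens :=
  ⟨{x}ᶜ, hx.isOpen_compl⟩

/-- The point `x` is the only common zero of the functions `g`, `h` on the open subset `U`. -/
def IsOnlyCommonZero {S : Scheme.{0}} {U : S.Opens} (g h : Γ(S, U)) (x : S) : Prop :=
  (U : Set S) ∩ S.zeroLocus {g, h} = {x}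

/-- The restriction of a function from `U` to a smaller open subset `V`, as a global function on
the scheme `V`. -/
def restrictFun {S : Scheme.{0}} {U V : S.Opens} (e : V ≤ U) (g : Γ(S, U)) :
    Γ(V.toScheme, ⊤) :=
  V.topIso.inv (S.presheaf.map (homOfLE e).op g)

lemma sup_basicOpen_restrictFun {S : Scheme.{0}} (x : S) (hx : IsClosed {x}) {U : S.Opens}
    (g h : Γ(S, U)) (hgh : IsOnlyCommonZero g h x) :
    (U ⊓ puncture x hx).toScheme.basicOpen (restrictFun inf_le_left g) ⊔
      (U ⊓ puncture x hx).toScheme.basicOpen (restrictFun inf_le_left h) = ⊤ := by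
  rw [eq_top_iff]
  intro y _
  have key : ∀ f : Γ(S, U), y.1 ∈ S.basicOpen f →
      y ∈ (U ⊓ puncture x hx).toScheme.basicOpen (restrictFun inf_le_left f) := by
    intro f hf
    have h1 : y.1 ∈ S.basicOpen
        (S.presheaf.map (homOfLE (inf_le_left : U ⊓ puncture x hx ≤ U)).op f) := by
      rw [Scheme.basicOpen_res]
      exact ⟨y.2, hf⟩
    rw [← Scheme.Opens.ι_image_basicOpen_topIso_inv] at h1
    obtain ⟨z, hz, hzy⟩ := h1
    have : z = y := Subtype.ext hzy
    exact this ▸ hz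
  by_contra hy
  have hy' : y.1 ∈ (U : Set S) ∩ S.zeroLocus {g, h} := by
    refine ⟨y.2.1, ?_⟩
    rw [Scheme.zeroLocus_def]
    simp only [Set.mem_insert_iff, Set.mem_singleton_iff, Set.mem_iInter]
    rintro f (rfl | rfl) hf
    · exact hy (Or.inl (key _ hf))
    · exact hy (Or.inr (key _ hf))
  rw [hgh] at hy'
  exact y.2.2 hy'

/-- The morphism `φ = (g, h) : U_* ⟶ 𝔸²_*`, where `U_* = U \ {x}`, given by two functions `g`, `h`
on `U` with `x` as their only common zero. -/
def puncturedMap {S : Scheme.{0}} (s : S ⟶ SpecC) (x : S) (hx : IsClosed {x}) {U : S.Opens}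
    (g h : Γ(S, U)) (hgh : IsOnlyCommonZero g h x) :
    (U ⊓ puncture x hx).toScheme ⟶ puncturedPlane.toScheme :=
  toPuncturedPlane ((U ⊓ puncture x hx).ι ≫ s) (restrictFun inf_le_left g)
    (restrictFun inf_le_left h) (sup_basicOpen_restrictFun x hx g h hgh)

end

/-! A principal `𝔾ₐ`-bundle on `S_*` corresponds to a class in `H¹(S_*, 𝒪)`, that is, to an
extension `0 → 𝒪 → E → 𝒪 → 0`. Such a bundle is a pullback of `SL₂` along `(g, h)` exactly when `E`
has a frame of determinant one whose images in the quotient `𝒪` are `g` and `h`: the first column of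
the matrix records these images, the second their local coordinates in the subsheaf `𝒪`, and
changing the local splitting by `c` is right multiplication by the unipotent matrix of `c`. The
theorem thus says that `E` is free near `x`, as expected of a reflexive module over a regular local
ring of dimension two.

Freeness is proved by hand. Let `u, v` generate the maximal ideal at `x`. Over `D(u)` and `D(v)` the
bundle has sections, and their difference has the form `a / (uv)^N`. A section of `E` on the
punctured neighbourhood is `(b, y / u^N, z / v^N)` with `a b + v^N y = u^N z`, so its germs at `x`
form a syzygy module. `IsLocalRing.exists_syzygies_le_span_pair` bounds its number of generators by
two, and `IsLocalRing.exists_syzygies_minor_eq` normalizes the determinant.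
`GaScheme.Sec.exists_isTwisted` turns the syzygies into sections of `E`, and
`GaScheme.nonempty_iso_puncturedMap` gives the isomorphism.

Off `x`, determinant one forbids common zeros of `g, h`. Both vanish at `x`: if one were a unit
there, `E` would split and the bundle would be trivial near `x`
(`GaScheme.Sec.IsTwisted.nonempty_sec`), hence trivial by excision
(`GaScheme.IsPrincipalBundle.isTrivial_of_sec_inf`). If the maximal ideal is principal, the
punctured neighbourhood is affine, and the same excision gives a contradiction.

Cohomology is replaced by sections and their differences: principal bundles are handled as torsors
on `T`-points, and vanishing on affines is an averaging argument
(`GaScheme.Sec.nonempty_of_span_eq_top`). -/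

/-! ### Regular sequences and syzygies -/

/-- Powers of a regular sequence form a regular sequence: strip the factors `v` one at a time, then
cancel one factor `u` at a time. -/
lemma pow_dvd_of_dvd_pow_mul {R : Type*} [CommRing R] [IsDomain R] {u v : R} (hu : u ≠ 0)
    (huv : ∀ w, u ∣ v * w → u ∣ w)
    (m n : ℕ) : ∀ w, u ^ m ∣ v ^ n * w → u ^ m ∣ w := by
  have h1 : ∀ n w, u ∣ v ^ n * w → u ∣ w := by
    intro n
    induction n with
    | zero => simp
    | succ n ih =>
      intro w hw
      rw [pow_succ', mul_assoc] at hw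
      exact ih w (huv _ hw)
  induction m with
  | zero => simp
  | succ m ih =>
    intro w hw
    obtain ⟨w, rfl⟩ := ih w ((pow_dvd_pow u m.le_succ).trans hw)
    rw [pow_succ, mul_left_comm] at hw
    rw [pow_succ]
    exact mul_dvd_mul_left _ (h1 n w ((mul_dvd_mul_iff_left (pow_ne_zero m hu)).mp hw))

/-- The module of syzygies of `(a, r, -q)` -/
def syzygies {R : Type*} [CommRing R] (a r q : R) : Submodule R (R × R × R) where
  carrier := {w | a * w.1 + r * w.2.1 = q * w.2.2}
  add_mem' {w w'} h h' := by
    simp only [Set.mem_ofPred_eq, Prod.fst_add, Prod.snd_add] at h h' ⊢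
    linear_combination h + h'
  zero_mem' := by simp
  smul_mem' c w h := by
    simp only [Set.mem_ofPred_eq, Prod.smul_fst, Prod.smul_snd, smul_eq_mul] at h ⊢
    linear_combination c * h

/-! ### Freeness of the syzygy module over a local ring with two parameters -/

namespace IsLocalRing

variable {R : Type*} [CommRing R] [IsLocalRing R] [IsNoetherianRing R]

/-- It suffices to treat primes. A prime containing the generator `v` is maximal; a prime `P` not
containing it satisfies `P = v P` and vanishes by Nakayama. -/
lemma isPrincipalIdealRing_of_isPrincipal_maximalIdeal (h : (maximalIdeal R).IsPrincipal) : IsPrincipalIdealRing R := by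
  obtain ⟨v, hv⟩ := h
  refine .of_prime fun P hP => ?_
  by_cases hvP : v ∈ P
  · have : P = maximalIdeal R := le_antisymm (le_maximalIdeal hP.ne_top) (by
      rw [hv, Submodule.span_singleton_le_iff_mem]
      exact hvP)
    exact this ▸ ⟨v, hv⟩
  · have : P = ⊥ := by
      refine Submodule.eq_bot_of_le_smul_of_le_jacobson_bot (maximalIdeal R) P
        (IsNoetherian.noetherian P) (fun x hx => ?_) (maximalIdeal_le_jacobson _)
      have hx' : x ∈ maximalIdeal R := le_maximalIdeal hP.ne_top hx
      rw [hv, Submodule.mem_span_singleton] at hx'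
      obtain ⟨y, rfl⟩ := hx'
      rw [smul_eq_mul] at hx
      rw [show y • v = v * y from mul_comm y v]
      refine Submodule.smul_mem_smul ?_ ((hP.mem_or_mem hx).resolve_right hvP)
      rw [hv]
      exact Submodule.mem_span_singleton_self v
    rw [this]
    infer_instance

variable {u v : R}

/-- The maximal ideal of `R ⧸ (u)` is generated by the class of `v`, so the image of `J` there is
principal. -/
lemma exists_mem_le_span_sup (hm : maximalIdeal R = Ideal.span {u, v}) (J : Ideal R) :
    ∃ j ∈ J, J ≤ Ideal.span {j} ⊔ Ideal.span {u} := by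
  have hu : u ∈ maximalIdeal R := hm ▸ Ideal.subset_span (by simp)
  have hne : Ideal.span {u} ≠ ⊤ := fun h =>
    (maximalIdeal.isMaximal R).ne_top
      (top_le_iff.mp (h ▸ (Ideal.span_singleton_le_iff_mem _).mpr hu))
  have : Nontrivial (R ⧸ Ideal.span {u}) := Ideal.Quotient.nontrivial_iff.mpr hne
  have : IsLocalRing (R ⧸ Ideal.span {u}) :=
    .of_surjective' (Ideal.Quotient.mk _) Ideal.Quotient.mk_surjective
  have hmax : maximalIdeal (R ⧸ Ideal.span {u}) =
      Ideal.span {Ideal.Quotient.mk (Ideal.span {u}) v} := by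
    rw [← map_maximalIdeal_of_surjective (Ideal.Quotient.mk (Ideal.span {u}))
      Ideal.Quotient.mk_surjective, hm, Ideal.map_span, Set.image_pair,
      Ideal.Quotient.eq_zero_iff_mem.mpr (Ideal.mem_span_singleton_self u), Ideal.span_insert_zero]
  have := isPrincipalIdealRing_of_isPrincipal_maximalIdeal ⟨_, hmax⟩
  obtain ⟨d, hd⟩ := (IsPrincipalIdealRing.principal (J.map (Ideal.Quotient.mk (Ideal.span {u}))))
  have hdJ : d ∈ J.map (Ideal.Quotient.mk (Ideal.span {u})) := by
    rw [hd]
    exact Submodule.mem_span_singleton_self d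
  obtain ⟨j, hj, rfl⟩ := (Ideal.mem_map_iff_of_surjective _ Ideal.Quotient.mk_surjective).mp hdJ
  refine ⟨j, hj, fun x hx => ?_⟩
  have hx' := Ideal.mem_map_of_mem (Ideal.Quotient.mk (Ideal.span {u})) hx
  rw [hd] at hx'
  obtain ⟨c, hc⟩ := Submodule.mem_span_singleton.mp hx'
  obtain ⟨c, rfl⟩ := Ideal.Quotient.mk_surjective c
  rw [smul_eq_mul, ← map_mul, eq_comm, Ideal.Quotient.mk_eq_mk_iff_sub_mem] at hc
  rw [Submodule.mem_sup]
  exact ⟨c * j, Ideal.mul_mem_left _ _ (Ideal.mem_span_singleton_self j), x - c * j, hc, by ring⟩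

/-- Call the module `M`. If `u` divides `b` and `z` in a syzygy `(b, y, z)`, it divides `y` too, and
the quotient is again a syzygy; so `M / uM` embeds in `(R ⧸ u)²` through `(b, z)`. As `R ⧸ u` is a
principal ideal ring, two generators suffice: `e₁` generates the first coordinates modulo `u`, and
`e₂` the last coordinates of the syzygies with `u ∣ b`. Nakayama lifts this to `M`. -/
lemma exists_syzygies_le_span_pair [IsDomain R] (hm : maximalIdeal R = Ideal.span {u, v})
    (hu : u ≠ 0) {a r q : R}
    (hr : ∀ w, u ∣ r * w → u ∣ w) (hq : u ∣ q) :
    ∃ e₁ ∈ syzygies a r q, ∃ e₂ ∈ syzygies a r q,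
      syzygies a r q ≤ Submodule.span R {e₁, e₂} := by
  have hum : u ∈ maximalIdeal R := hm ▸ Ideal.subset_span (by simp)
  set M := syzygies a r q with hM
  obtain ⟨_, ⟨e₁, he₁, rfl⟩, h₁⟩ :=
    exists_mem_le_span_sup hm (M.map (LinearMap.fst R R (R × R)))
  obtain ⟨_, ⟨e₂, ⟨he₂, hb₂⟩, rfl⟩, h₂⟩ :=
    exists_mem_le_span_sup hm
      ((M ⊓ Submodule.comap (LinearMap.fst R R (R × R)) (Ideal.span {u})).map
      (LinearMap.snd R R R ∘ₗ LinearMap.snd R R (R × R)))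
  refine ⟨e₁, he₁, e₂, he₂, ?_⟩
  refine Submodule.le_of_le_smul_of_le_jacobson_bot (I := maximalIdeal R)
    (IsNoetherian.noetherian M) (maximalIdeal_le_jacobson _) fun w hw => ?_
  obtain ⟨_, hs₁, _, hs₂, hs⟩ := Submodule.mem_sup.mp (h₁ ⟨w, hw, rfl⟩)
  obtain ⟨c₁, rfl⟩ := Ideal.mem_span_singleton'.mp hs₁
  have hw₁ : w - c₁ • e₁ ∈ M := M.sub_mem hw (M.smul_mem _ he₁)
  have hb₁ : u ∣ (w - c₁ • e₁).1 := by
    rw [← Ideal.mem_span_singleton]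
    convert hs₂ using 1
    simp only [LinearMap.fst_apply] at hs
    simp [← hs]
  obtain ⟨_, ht₁, _, ht₂, ht⟩ := Submodule.mem_sup.mp
    (h₂ ⟨_, ⟨hw₁, Ideal.mem_span_singleton.mpr hb₁⟩, rfl⟩)
  obtain ⟨c₂, rfl⟩ := Ideal.mem_span_singleton'.mp ht₁
  have hw₂ : w - c₁ • e₁ - c₂ • e₂ ∈ M := M.sub_mem hw₁ (M.smul_mem _ he₂)
  have hb : u ∣ (w - c₁ • e₁ - c₂ • e₂).1 :=
    dvd_sub hb₁ (Dvd.dvd.mul_left (Ideal.mem_span_singleton.mp hb₂) c₂)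
  have hz : u ∣ (w - c₁ • e₁ - c₂ • e₂).2.2 := by
    rw [← Ideal.mem_span_singleton]
    convert ht₂ using 1
    simp only [LinearMap.comp_apply, LinearMap.snd_apply] at ht
    rw [Prod.snd_sub, Prod.snd_sub, ← ht]
    simp
  generalize hw' : w - c₁ • e₁ - c₂ • e₂ = w' at hw₂ hb hz
  obtain ⟨b, y, z⟩ := w'
  have hrel : a * b + r * y = q * z := hw₂
  have hy : u ∣ y := by
    apply hr
    rw [eq_sub_of_add_eq' hrel]
    exact dvd_sub (hq.mul_right _) (Dvd.dvd.mul_left hb _)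
  obtain ⟨b, rfl⟩ := hb
  obtain ⟨y, rfl⟩ := hy
  obtain ⟨z, rfl⟩ : u ∣ z := hz
  have hw'' : (b, y, z) ∈ M := by
    change a * b + r * y = q * z
    exact mul_left_cancel₀ hu (by linear_combination hrel)
  refine Submodule.mem_sup.mpr ⟨c₁ • e₁ + c₂ • e₂, ?_, u • (b, y, z),
    Submodule.smul_mem_smul hum hw'', ?_⟩
  · exact Submodule.mem_span_pair.mpr ⟨c₁, c₂, rfl⟩
  · have : u • (b, y, z) = (u * b, u * y, u * z) := rfl
    rw [this, ← hw']
    abel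

/-- Every element of the local cohomology of a regular local ring of dimension two is the class of
an extension that is free of rank two. -/
lemma exists_syzygies_minor_eq [IsDomain R] (hm : maximalIdeal R = Ideal.span {u, v})
    (hu : u ≠ 0) (huv : ∀ w, u ∣ v * w → u ∣ w)
    (a : R) {N : ℕ} (hN : N ≠ 0) :
    ∃ b₁ y₁ z₁ b₂ y₂ z₂ : R, a * b₁ + v ^ N * y₁ = u ^ N * z₁ ∧
      a * b₂ + v ^ N * y₂ = u ^ N * z₂ ∧ b₁ * y₂ - b₂ * y₁ = u ^ N ∧
      b₁ * z₂ - b₂ * z₁ = v ^ N := by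
  have hr := pow_dvd_of_dvd_pow_mul hu huv N N
  have hr₁ := pow_dvd_of_dvd_pow_mul hu huv 1 N
  rw [pow_one] at hr₁
  have hq : u ∣ u ^ N := dvd_pow_self u hN
  have hq0 : u ^ N ≠ 0 := pow_ne_zero N hu
  generalize u ^ N = q at *
  generalize v ^ N = r at *
  obtain ⟨⟨b₁, y₁, z₁⟩, h₁, ⟨b₂, y₂, z₂⟩, h₂, hM⟩ :=
    exists_syzygies_le_span_pair hm hu hr₁ hq (a := a)
  change a * b₁ + r * y₁ = q * z₁ at h₁
  change a * b₂ + r * y₂ = q * z₂ at h₂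
  have key : ∀ b y z, a * b + r * y = q * z → ∃ c d, c * b₁ + d * b₂ = b ∧ c * y₁ + d * y₂ = y ∧
      c * z₁ + d * z₂ = z := by
    intro b y z h
    obtain ⟨c, d, hcd⟩ := Submodule.mem_span_pair.mp (hM (show (b, y, z) ∈ syzygies a r q from h))
    exact ⟨c, d, congrArg Prod.fst hcd, congrArg (fun w => w.2.1) hcd,
      congrArg (fun w => w.2.2) hcd⟩
  -- The three evident syzygies. In the coordinates `(b, y)` the first two have minor `q²`; in `(b,
  -- z)` the last two have minor `r²` up to sign. Hence the minors of the generators divide these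
  -- squares.
  obtain ⟨c₁, d₁, hb₁, hy₁, -⟩ := key q 0 a (by ring)
  obtain ⟨c₂, d₂, hb₂, hy₂, hz₂⟩ := key 0 q r (by ring)
  obtain ⟨c₃, d₃, hb₃, -, hz₃⟩ := key r (-a) 0 (by ring)
  have hδ : r * (b₁ * y₂ - b₂ * y₁) = q * (b₁ * z₂ - b₂ * z₁) := by
    linear_combination b₁ * h₂ - b₂ * h₁
  -- By regularity the two minors of the generators are `q t` and `r t` for a common `t`. The rest
  -- shows that `t` is a unit, whose inverse `s` then rescales the second generator.
  obtain ⟨t, ht⟩ := hr _ ⟨_, hδ⟩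
  have ht' : b₁ * z₂ - b₂ * z₁ = r * t := mul_left_cancel₀ hq0 (by rw [← hδ, ht]; ring)
  have hr0 : r ≠ 0 := by
    rintro rfl
    have h1 : u ∣ 1 := hr₁ 1 (by simp)
    exact (mem_maximalIdeal u).mp (hm ▸ Ideal.subset_span (by simp)) (isUnit_of_dvd_one h1)
  have e₁ : q = (c₁ * d₂ - d₁ * c₂) * t := by
    apply mul_left_cancel₀ hq0
    have : q * q = (c₁ * d₂ - d₁ * c₂) * (b₁ * y₂ - b₂ * y₁) := by
      linear_combination (-(c₂ * y₁ + d₂ * y₂)) * hb₁ + (c₁ * y₁ + d₁ * y₂) * hb₂ - q * hy₂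
    rw [this, ht]
    ring
  have e₂ : r = (c₃ * d₂ - d₃ * c₂) * t := by
    apply mul_left_cancel₀ hr0
    have : r * r = (c₃ * d₂ - d₃ * c₂) * (b₁ * z₂ - b₂ * z₁) := by
      linear_combination (-(c₂ * z₁ + d₂ * z₂)) * hb₃ + (c₃ * z₁ + d₃ * z₂) * hb₂ - r * hz₂
    rw [this, ht']
    ring
  obtain ⟨s, hs⟩ := hr (c₁ * d₂ - d₁ * c₂) ⟨c₃ * d₂ - d₃ * c₂, by
    linear_combination (c₁ * d₂ - d₁ * c₂) * e₂ - (c₃ * d₂ - d₃ * c₂) * e₁⟩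
  have hts : t * s = 1 := mul_left_cancel₀ hq0 (by
    rw [hs] at e₁
    linear_combination - e₁)
  exact ⟨b₁, y₁, z₁, s * b₂, s * y₂, s * z₂, h₁, by linear_combination s * h₂,
    by linear_combination s * ht + q * hts, by linear_combination s * ht' + r * hts⟩

/-! ### Generators of the maximal ideal in dimension two form a regular sequence -/

/-- If `c u + d v ∈ P`, then `d v ∈ P` and so `d ∈ P`. Thus `P = (u) + v P`, and Nakayama applies.
-/
lemma eq_span_singleton_of_isPrime (hm : maximalIdeal R = Ideal.span {u, v}) {P : Ideal R}
    (hP : P.IsPrime) (hu : u ∈ P) (hv : v ∉ P) : P = Ideal.span {u} := by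
  refine le_antisymm ?_ ((Ideal.span_singleton_le_iff_mem _).mpr hu)
  refine Submodule.le_of_le_smul_of_le_jacobson_bot (I := maximalIdeal R)
    (IsNoetherian.noetherian P) (maximalIdeal_le_jacobson _) fun x hx => ?_
  have hx' : x ∈ maximalIdeal R := le_maximalIdeal hP.ne_top hx
  rw [hm] at hx'
  obtain ⟨c, d, rfl⟩ := Ideal.mem_span_pair.mp hx'
  have hd : d ∈ P :=
    (hP.mem_or_mem ((P.add_mem_iff_right (P.mul_mem_left c hu)).mp hx)).resolve_right hv
  refine Submodule.mem_sup.mpr ⟨c * u, Ideal.mul_mem_left _ _ (Ideal.mem_span_singleton_self u),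
    d * v, ?_, rfl⟩
  rw [mul_comm]
  exact Submodule.smul_mem_smul (hm ▸ Ideal.subset_span (by simp)) hd

lemma notMem_minimalPrimes_of_ringKrullDim_eq_two (hdim : ringKrullDim R = 2) (x : R) :
    maximalIdeal R ∉ (Ideal.span {x}).minimalPrimes := by
  intro h
  have := Ideal.height_le_one_of_isPrincipal_of_mem_minimalPrimes (Ideal.span {x}) _ h
  have h2 := maximalIdeal_height_eq_ringKrullDim (R := R)
  rw [hdim] at h2
  have h3 : (maximalIdeal R).height = 2 := WithBot.coe_injective h2
  rw [h3] at this
  exact absurd this (by decide)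

/-- A minimal prime over `u` has height at most one by Krull, so it is not the maximal ideal and
cannot contain `v`; by `eq_span_singleton_of_isPrime` it is then `(u)` itself. -/
lemma isPrime_span_singleton (hm : maximalIdeal R = Ideal.span {u, v})
    (hdim : ringKrullDim R = 2) : (Ideal.span {u}).IsPrime ∧ v ∉ Ideal.span {u} := by
  have hu : u ∈ maximalIdeal R := hm ▸ Ideal.subset_span (by simp)
  obtain ⟨P, hP, hPm⟩ := Ideal.exists_minimalPrimes_le
    ((Ideal.span_singleton_le_iff_mem _).mpr hu)
  have hPp : P.IsPrime := hP.1.1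
  have huP : u ∈ P := hP.1.2 (Ideal.mem_span_singleton_self u)
  have hvP : v ∉ P := by
    intro hv
    refine notMem_minimalPrimes_of_ringKrullDim_eq_two hdim u ?_
    have : maximalIdeal R = P := le_antisymm (by
      rw [hm, Ideal.span_le]
      rintro _ (rfl | rfl)
      · exact huP
      · exact hv) hPm
    rwa [this]
  rw [← eq_span_singleton_of_isPrime hm hPp huP hvP]
  exact ⟨hPp, hvP⟩

lemma dvd_of_dvd_mul_of_ringKrullDim_eq_two (hm : maximalIdeal R = Ideal.span {u, v})
    (hdim : ringKrullDim R = 2) : ∀ w, u ∣ v * w → u ∣ w := by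
  obtain ⟨hP, hv⟩ := isPrime_span_singleton hm hdim
  intro w hw
  rw [← Ideal.mem_span_singleton] at hw ⊢
  exact (hP.mem_or_mem hw).resolve_left hv

lemma ne_zero_of_ringKrullDim_eq_two (hm : maximalIdeal R = Ideal.span {u, v})
    (hdim : ringKrullDim R = 2) : u ≠ 0 := by
  rintro rfl
  refine notMem_minimalPrimes_of_ringKrullDim_eq_two hdim v ?_
  have : maximalIdeal R = Ideal.span {v} := by rw [hm, Ideal.span_insert_zero]
  rw [← this, Ideal.minimalPrimes_eq_subsingleton_self]
  rfl

/-- The maximal ideal of a regular local ring of dimension at most two is principal, or the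
dimension is two and it is generated by two elements. -/
lemma exists_maximalIdeal_eq_span_pair {R : Type*} [CommRing R] [hR : IsRegularLocalRing R]
    (hdim : ringKrullDim R ≤ 2) : ∃ u v : R, maximalIdeal R = Ideal.span {u, v} ∧
      (v = 0 ∨ ringKrullDim R = 2) := by
  have h := hR.spanFinrank_maximalIdeal
  have h2 : (maximalIdeal R).spanFinrank ≤ 2 := by
    rw [← h] at hdim
    exact_mod_cast hdim
  classical
  obtain ⟨s, hs, hs'⟩ := Submodule.FG.exists_span_finset_card_eq_spanFinrank
    (IsNoetherian.noetherian (maximalIdeal R))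
  rw [← h]
  rw [← hs] at h2 ⊢
  interval_cases hc : s.card
  · rw [Finset.card_eq_zero] at hc
    subst hc
    exact ⟨0, 0, by simp [← hs'], Or.inl rfl⟩
  · obtain ⟨u, rfl⟩ := Finset.card_eq_one.mp hc
    refine ⟨u, 0, ?_, Or.inl rfl⟩
    rw [← hs', Ideal.span_pair_zero]
    simp
  · obtain ⟨u, v, -, hs⟩ := Finset.card_eq_two.mp hc
    exact ⟨u, v, by rw [← hs', hs]; simp, Or.inr (by simp)⟩

end IsLocalRing

/-! ### Torsors under the additive group, in terms of `T`-points -/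

noncomputable section

lemma gaPoint_injective {T P : Scheme.{0}} {p : T ⟶ P} {c d : Γ(T, ⊤)}
    (h : gaPoint p c = gaPoint p d) : c = d := by
  rw [← gaPoint_coord p c, h, gaPoint_coord]

lemma eq_gaPoint {T P : Scheme.{0}} (m : T ⟶ 𝔸(Unit; P)) :
    m = gaPoint (m ≫ (𝔸(Unit; P) ↘ P)) (m.appTop (AffineSpace.coord P ())) := by
  apply AffineSpace.hom_ext
  · rw [gaPoint_over]
  · intro i
    rw [gaPoint_coord]

namespace GaScheme

variable {X Y : Scheme.{0}}

lemma exists_glued_hom (𝒰 : Scheme.OpenCover.{0} X) {T Z : Scheme.{0}} (t : T ⟶ X)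
    (m : ∀ i, Limits.pullback t (𝒰.f i) ⟶ Z)
    (h : ∀ (T' : Scheme.{0}) (i j) (a : T' ⟶ Limits.pullback t (𝒰.f i))
      (b : T' ⟶ Limits.pullback t (𝒰.f j)),
      a ≫ pullback.fst _ _ = b ≫ pullback.fst _ _ → a ≫ m i = b ≫ m j) :
    ∃ F : T ⟶ Z, ∀ i, pullback.fst t (𝒰.f i) ≫ F = m i :=
  ⟨Scheme.Cover.glueMorphisms (𝒰.pullback₁ t) m fun i j => h _ i j _ _ pullback.condition,
    fun i => Scheme.Cover.ι_glueMorphisms (𝒰.pullback₁ t) m _ i⟩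

lemma hom_ext_of_openCover (𝒰 : Scheme.OpenCover.{0} X) {T Z : Scheme.{0}} (t : T ⟶ X)
    {f g : T ⟶ Z} (h : ∀ i, pullback.fst t (𝒰.f i) ≫ f = pullback.fst t (𝒰.f i) ≫ g) : f = g :=
  Scheme.Cover.hom_ext (𝒰.pullback₁ t) f g h

/-- The translate `p · c` of a `T`-point `p` by a `T`-point `c` of `𝔾ₐ`. -/
def trans (P : GaScheme X) {T : Scheme.{0}} (p : T ⟶ P.total) (c : Γ(T, ⊤)) : T ⟶ P.total :=
  gaPoint p c ≫ P.act

section trans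

variable (P : GaScheme X) {T T' : Scheme.{0}} (p : T ⟶ P.total) (c d : Γ(T, ⊤))

lemma trans_proj : P.trans p c ≫ P.proj = p ≫ P.proj := by
  rw [trans, Category.assoc, P.act_proj, gaPoint_comp_over]

lemma trans_zero : P.trans p 0 = p := P.act_zero T p

lemma trans_trans : P.trans (P.trans p c) d = P.trans p (c + d) := P.act_add T p c d

lemma comp_trans (e : T' ⟶ T) : e ≫ P.trans p c = P.trans (e ≫ p) (e.appTop c) := by
  rw [trans, trans, ← Category.assoc, comp_gaPoint]

lemma Iso.trans_hom {P Q : GaScheme X} (e : P.Iso Q) (p : T ⟶ P.total) (c : Γ(T, ⊤)) :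
    P.trans p c ≫ e.iso.hom = Q.trans (p ≫ e.iso.hom) c := by
  rw [trans, trans, Category.assoc, e.equivariant, ← Category.assoc, gaPoint_map]

/-- The projection of a pullback to the original total space. -/
def pullbackSnd (f : Y ⟶ X) : (P.pullback f).total ⟶ P.total := pullback.snd f P.proj

lemma pullbackSnd_proj (f : Y ⟶ X) : P.pullbackSnd f ≫ P.proj = (P.pullback f).proj ≫ f :=
  pullback.condition.symm

/-- The point of the pullback `f^*P` given by a point of the base and a point of `P`. -/
def pullbackLift (f : Y ⟶ X) (b : T ⟶ Y) (q : T ⟶ P.total) (h : b ≫ f = q ≫ P.proj) :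
    T ⟶ (P.pullback f).total := pullback.lift b q h

lemma pullbackLift_proj (f : Y ⟶ X) (b : T ⟶ Y) (q : T ⟶ P.total) (h : b ≫ f = q ≫ P.proj) :
    P.pullbackLift f b q h ≫ (P.pullback f).proj = b := pullback.lift_fst _ _ _

lemma pullbackLift_snd (f : Y ⟶ X) (b : T ⟶ Y) (q : T ⟶ P.total) (h : b ≫ f = q ≫ P.proj) :
    P.pullbackLift f b q h ≫ P.pullbackSnd f = q := pullback.lift_snd _ _ _

variable {P} in
lemma pullback_hom_ext {f : Y ⟶ X} {p q : T ⟶ (P.pullback f).total}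
    (h₁ : p ≫ (P.pullback f).proj = q ≫ (P.pullback f).proj)
    (h₂ : p ≫ P.pullbackSnd f = q ≫ P.pullbackSnd f) : p = q := pullback.hom_ext h₁ h₂

lemma pullback_act_snd (f : Y ⟶ X) : (P.pullback f).act ≫ P.pullbackSnd f =
    AffineSpace.map Unit (P.pullbackSnd f) ≫ P.act := pullback.lift_snd _ _ _

lemma trans_pullbackSnd (f : Y ⟶ X) (p : T ⟶ (P.pullback f).total) (c : Γ(T, ⊤)) :
    (P.pullback f).trans p c ≫ P.pullbackSnd f = P.trans (p ≫ P.pullbackSnd f) c := by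
  rw [trans, trans, Category.assoc, pullback_act_snd, ← Category.assoc, gaPoint_map]

lemma pullback_trans_eq_iff (f : Y ⟶ X) {p q : T ⟶ (P.pullback f).total}
    (h : p ≫ (P.pullback f).proj = q ≫ (P.pullback f).proj) (c : Γ(T, ⊤)) :
    (P.pullback f).trans p c = q ↔ P.trans (p ≫ P.pullbackSnd f) c = q ≫ P.pullbackSnd f := by
  rw [← trans_pullbackSnd]
  refine ⟨fun h => by rw [h], fun h' => pullback_hom_ext ?_ h'⟩
  rw [trans_proj, h]

/-- The second coordinate of a point of the trivial bundle. -/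
def trivialCoord (p : T ⟶ (trivial X).total) : Γ(T, ⊤) :=
  Scheme.Hom.appTop (Y := 𝔸(Unit; X)) p (AffineSpace.coord X ())

lemma trivial_hom_ext {p q : T ⟶ (trivial X).total}
    (h : p ≫ (trivial X).proj = q ≫ (trivial X).proj) (h' : trivialCoord p = trivialCoord q) :
    p = q :=
  AffineSpace.hom_ext h fun _ => h'

lemma trivialCoord_trans (p : T ⟶ (trivial X).total) (c : Γ(T, ⊤)) :
    trivialCoord ((trivial X).trans p c) = trivialCoord p + c := by
  have key : ∀ q : T ⟶ 𝔸(Unit; X), gaPoint q c ≫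
      gaPoint ((𝔸(Unit; 𝔸(Unit; X)) ↘ 𝔸(Unit; X)) ≫ (𝔸(Unit; X) ↘ X))
        ((𝔸(Unit; 𝔸(Unit; X)) ↘ 𝔸(Unit; X)).appTop (AffineSpace.coord X ()) +
          AffineSpace.coord 𝔸(Unit; X) ()) =
      gaPoint (q ≫ (𝔸(Unit; X) ↘ X)) (q.appTop (AffineSpace.coord X ()) + c) := by
    intro q
    rw [comp_gaPoint, gaPoint_comp_over, map_add, gaPoint_coord, ← CommRingCat.comp_apply,
      ← Scheme.Hom.comp_appTop, gaPoint_over]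
  have := congrArg (fun r : T ⟶ 𝔸(Unit; X) => r.appTop (AffineSpace.coord X ())) (key p)
  exact this.trans (gaPoint_coord _ _)

end trans

/-- `𝔾ₐ` acts simply transitively on the `T`-points of `P` over each `T`-point of `X`. -/
def IsTorsor (P : GaScheme X) : Prop :=
  ∀ ⦃T : Scheme.{0}⦄ (p q : T ⟶ P.total), p ≫ P.proj = q ≫ P.proj → ∃! c, P.trans p c = q

lemma isTorsor_trivial (X : Scheme.{0}) : (trivial X).IsTorsor := by
  intro T p q h
  refine ⟨trivialCoord q - trivialCoord p, ?_, ?_⟩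
  · apply trivial_hom_ext
    · rw [trans_proj, h]
    · rw [trivialCoord_trans, add_sub_cancel]
  · intro c hc
    rw [← hc, trivialCoord_trans, add_sub_cancel_left]

lemma Iso.isTorsor {P Q : GaScheme X} (e : P.Iso Q) (hQ : Q.IsTorsor) : P.IsTorsor := by
  intro T p q h
  have key : ∀ c, P.trans p c = q ↔ Q.trans (p ≫ e.iso.hom) c = q ≫ e.iso.hom := by
    intro c
    rw [← e.trans_hom, cancel_mono]
  simp only [key]
  apply hQ
  rw [Category.assoc, Category.assoc, e.hom_proj, h]

lemma IsTorsor.pullback {P : GaScheme X} (hP : P.IsTorsor) (f : Y ⟶ X) :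
    (P.pullback f).IsTorsor := by
  intro T p q h
  simp only [pullback_trans_eq_iff P f h]
  apply hP
  rw [Category.assoc, Category.assoc, pullbackSnd_proj, ← Category.assoc, h, Category.assoc]

/-- Uniqueness of the translating function makes the local solutions agree on overlaps, so simple
transitivity is Zariski local on the base. -/
lemma isTorsor_of_openCover {P : GaScheme X} (𝒰 : Scheme.OpenCover.{0} X)
    (h : ∀ i, (P.pullback (𝒰.f i)).IsTorsor) : P.IsTorsor := by
  intro T p q hpq
  have key : ∀ (T' : Scheme.{0}) (e : T' ⟶ T) (i) (b : T' ⟶ 𝒰.X i),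
      e ≫ p ≫ P.proj = b ≫ 𝒰.f i → ∃! c, P.trans (e ≫ p) c = e ≫ q := by
    intro T' e i b hb
    let p' : T' ⟶ (P.pullback (𝒰.f i)).total := P.pullbackLift _ b (e ≫ p)
      (by rw [Category.assoc, hb])
    let q' : T' ⟶ (P.pullback (𝒰.f i)).total := P.pullbackLift _ b (e ≫ q)
      (by rw [Category.assoc, ← hpq, hb])
    have hp' : p' ≫ P.pullbackSnd _ = e ≫ p := pullbackLift_snd _ _ _ _ _
    have hq' : q' ≫ P.pullbackSnd _ = e ≫ q := pullbackLift_snd _ _ _ _ _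
    have hf : p' ≫ (P.pullback (𝒰.f i)).proj = q' ≫ (P.pullback (𝒰.f i)).proj := by
      rw [pullbackLift_proj, pullbackLift_proj]
    simpa only [pullback_trans_eq_iff P _ hf, hp', hq'] using h i p' q' hf
  choose c hc _ using fun i => key _ (pullback.fst (p ≫ P.proj) (𝒰.f i)) i _ pullback.condition
  -- The local functions are glued together with `p`, as a morphism to `P × 𝔾ₐ`; the function sought
  -- is its second coordinate.
  obtain ⟨m, hm⟩ := exists_glued_hom 𝒰 (p ≫ P.proj)
    (fun i => gaPoint (pullback.fst (p ≫ P.proj) (𝒰.f i) ≫ p) (c i)) (by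
      intro T' i j a b hab
      rw [comp_gaPoint, comp_gaPoint, ← Category.assoc, ← Category.assoc, hab]
      congr 1
      refine (key _ (b ≫ pullback.fst _ _) j (b ≫ pullback.snd _ _)
        (by simp only [Category.assoc, pullback.condition])).unique ?_ ?_
      · rw [← hab, Category.assoc, ← comp_trans, hc, Category.assoc]
      · rw [Category.assoc, ← comp_trans, hc, Category.assoc])
  have hmp : m ≫ (𝔸(Unit; P.total) ↘ P.total) = p := by
    apply hom_ext_of_openCover 𝒰 (p ≫ P.proj)
    intro i
    rw [← Category.assoc, hm, gaPoint_over]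
  have hmc := eq_gaPoint m
  rw [hmp] at hmc
  refine ⟨m.appTop (AffineSpace.coord _ ()), ?_, ?_⟩
  · dsimp only
    rw [trans, ← hmc]
    apply hom_ext_of_openCover 𝒰 (p ≫ P.proj)
    intro i
    rw [← Category.assoc, hm]
    exact hc i
  · intro d hd
    apply gaPoint_injective (p := p)
    apply hom_ext_of_openCover 𝒰 (p ≫ P.proj)
    intro i
    rw [comp_gaPoint, comp_gaPoint]
    congr 1
    refine (key _ (pullback.fst (p ≫ P.proj) (𝒰.f i)) i _ pullback.condition).unique ?_ ?_
    · rw [← comp_trans, hd]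
    · rw [← comp_trans, trans, ← hmc, ← Category.assoc, hm]
      exact hc i

lemma IsPrincipalBundle.isTorsor {P : GaScheme X} (hP : P.IsPrincipalBundle) : P.IsTorsor := by
  choose V hV hV' using hP
  let 𝒰 : Scheme.OpenCover.{0} X := X.openCoverOfIsOpenCover V (.mk (by
    rw [eq_top_iff]
    exact fun y _ => TopologicalSpace.Opens.mem_iSup.mpr ⟨y, hV y⟩))
  exact isTorsor_of_openCover 𝒰 fun i => (hV' i).some.isTorsor (isTorsor_trivial _)

/-- Local sections with compatible difference cocycles determine an equivariant morphism. -/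
lemma exists_hom_of_sections {P Q : GaScheme X} (hP : P.IsTorsor) (𝒰 : Scheme.OpenCover.{0} X)
    (σ : ∀ i, 𝒰.X i ⟶ P.total) (τ : ∀ i, 𝒰.X i ⟶ Q.total)
    (hσ : ∀ i, σ i ≫ P.proj = 𝒰.f i)
    (h : ∀ (T : Scheme.{0}) (i j) (a : T ⟶ 𝒰.X i) (b : T ⟶ 𝒰.X j), a ≫ 𝒰.f i = b ≫ 𝒰.f j →
      ∀ c, P.trans (a ≫ σ i) c = b ≫ σ j → Q.trans (a ≫ τ i) c = b ≫ τ j) :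
    ∃ F : P.total ⟶ Q.total, ∀ (T : Scheme.{0}) (i) (a : T ⟶ 𝒰.X i) (c : Γ(T, ⊤)),
      P.trans (a ≫ σ i) c ≫ F = Q.trans (a ≫ τ i) c := by
  -- `c i` is the universal coordinate over the `i`-th chart: the tautological point of `P` is `σ i`
  -- translated by `c i`. The morphism sends it to `τ i` translated by `c i`.
  choose c hc _ using fun i => hP (pullback.snd P.proj (𝒰.f i) ≫ σ i) (pullback.fst P.proj (𝒰.f i))
    (by rw [pullback.condition, Category.assoc, hσ])
  have main : ∀ (T : Scheme.{0}) (i j) (a : T ⟶ 𝒰.X i) (b : T ⟶ 𝒰.X j) (c d : Γ(T, ⊤)),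
      P.trans (a ≫ σ i) c = P.trans (b ≫ σ j) d → Q.trans (a ≫ τ i) c = Q.trans (b ≫ τ j) d := by
    intro T i j a b c d hab
    have e : a ≫ 𝒰.f i = b ≫ 𝒰.f j := by
      have := congrArg (· ≫ P.proj) hab
      simpa only [trans_proj, Category.assoc, hσ] using this
    have := h T i j a b e (c - d) (by
      rw [sub_eq_add_neg, ← trans_trans, hab, trans_trans, add_neg_cancel, trans_zero])
    rw [← this, trans_trans, sub_add_cancel]
  obtain ⟨F, hF⟩ := exists_glued_hom 𝒰 P.proj
    (fun i => Q.trans (pullback.snd P.proj (𝒰.f i) ≫ τ i) (c i)) (by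
      intro T i j a b hab
      rw [comp_trans, comp_trans, ← Category.assoc, ← Category.assoc]
      apply main
      rw [Category.assoc, Category.assoc, ← comp_trans, ← comp_trans, hc i, hc j, hab])
  refine ⟨F, fun T i a d => ?_⟩
  have hl : P.trans (a ≫ σ i) d ≫ P.proj = a ≫ 𝒰.f i := by
    rw [trans_proj, Category.assoc, hσ]
  rw [← pullback.lift_fst _ _ hl, Category.assoc, hF, comp_trans, ← Category.assoc,
    pullback.lift_snd]
  apply main
  conv_rhs => rw [← pullback.lift_fst _ _ hl, ← hc i, comp_trans, ← Category.assoc,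
    pullback.lift_snd]

/-- Torsors with local sections that have the same difference cocycles are isomorphic. -/
lemma nonempty_iso_of_sections {P Q : GaScheme X} (hP : P.IsTorsor) (hQ : Q.IsTorsor)
    (𝒰 : Scheme.OpenCover.{0} X) (σ : ∀ i, 𝒰.X i ⟶ P.total) (τ : ∀ i, 𝒰.X i ⟶ Q.total)
    (hσ : ∀ i, σ i ≫ P.proj = 𝒰.f i) (hτ : ∀ i, τ i ≫ Q.proj = 𝒰.f i)
    (h : ∀ (T : Scheme.{0}) (i j) (a : T ⟶ 𝒰.X i) (b : T ⟶ 𝒰.X j), a ≫ 𝒰.f i = b ≫ 𝒰.f j →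
      ∃ c, P.trans (a ≫ σ i) c = b ≫ σ j ∧ Q.trans (a ≫ τ i) c = b ≫ τ j) :
    Nonempty (P.Iso Q) := by
  obtain ⟨F, hF⟩ := exists_hom_of_sections (Q := Q) hP 𝒰 σ τ hσ (by
    intro T i j a b hab c hc
    obtain ⟨d, hd, hd'⟩ := h T i j a b hab
    rwa [(hP (a ≫ σ i) (b ≫ σ j) (by simp only [Category.assoc, hσ, hab])).unique hc hd])
  obtain ⟨G, hG⟩ := exists_hom_of_sections (Q := P) hQ 𝒰 τ σ hτ (by
    intro T i j a b hab c hc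
    obtain ⟨d, hd, hd'⟩ := h T i j a b hab
    rwa [(hQ (a ≫ τ i) (b ≫ τ j) (by simp only [Category.assoc, hτ, hab])).unique hc hd'])
  -- Every point of a torsor is locally a translate of one of the given sections, so equalities of
  -- morphisms need checking only on such translates.
  have hloc : ∀ {R : GaScheme X} (_ : R.IsTorsor) (ρ : ∀ i, 𝒰.X i ⟶ R.total)
      (_ : ∀ i, ρ i ≫ R.proj = 𝒰.f i) {T Z : Scheme.{0}} (p : T ⟶ R.total) (f g : T ⟶ Z),
      (∀ (T' : Scheme.{0}) (e : T' ⟶ T) (i) (a : T' ⟶ 𝒰.X i) (c : Γ(T', ⊤)),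
        e ≫ p = R.trans (a ≫ ρ i) c → e ≫ f = e ≫ g) → f = g := by
    intro R hR ρ hρ T Z p f g hfg
    apply hom_ext_of_openCover 𝒰 (p ≫ R.proj)
    intro i
    obtain ⟨c, hc, -⟩ := hR (pullback.snd (p ≫ R.proj) (𝒰.f i) ≫ ρ i)
      (pullback.fst (p ≫ R.proj) (𝒰.f i) ≫ p)
      (by rw [Category.assoc, hρ, Category.assoc, pullback.condition])
    exact hfg _ _ i _ c hc.symm
  refine ⟨⟨⟨F, G, ?_, ?_⟩, ?_, ?_⟩⟩
  · apply hloc hP σ hσ (𝟙 _)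
    intro T e i a c he
    rw [Category.comp_id] at he
    rw [he, ← Category.assoc, hF, hG, Category.comp_id]
  · apply hloc hQ τ hτ (𝟙 _)
    intro T e i a c he
    rw [Category.comp_id] at he
    rw [he, ← Category.assoc, hG, hF, Category.comp_id]
  · apply hloc hP σ hσ (𝟙 _)
    intro T e i a c he
    rw [Category.comp_id] at he
    rw [he, ← Category.assoc, hF, trans_proj, trans_proj, Category.assoc, Category.assoc, hσ, hτ]
  · apply hloc hP σ hσ (𝔸(Unit; P.total) ↘ P.total)
    intro T e i a c he
    rw [eq_gaPoint e, he]
    generalize e.appTop (AffineSpace.coord _ ()) = d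
    have h1 : gaPoint (P.trans (a ≫ σ i) c) d ≫ P.act = P.trans (a ≫ σ i) (c + d) :=
      trans_trans _ _ _ _
    have h2 : gaPoint (Q.trans (a ≫ τ i) c) d ≫ Q.act = Q.trans (a ≫ τ i) (c + d) :=
      trans_trans _ _ _ _
    rw [← Category.assoc, h1, hF, ← Category.assoc, gaPoint_map, hF, h2]

/-- A torsor with a global section is trivial. -/
lemma IsTorsor.isTrivial {P : GaScheme X} (hP : P.IsTorsor) (σ : X ⟶ P.total)
    (hσ : σ ≫ P.proj = 𝟙 X) : P.IsTrivial := by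
  let 𝒰 : Scheme.OpenCover.{0} X := Scheme.coverOfIsIso (𝟙 X)
  refine nonempty_iso_of_sections hP (isTorsor_trivial X) 𝒰 (fun _ => σ)
    (fun _ => gaPoint (𝟙 X) 0) (fun _ => hσ) (fun _ => gaPoint_over _ _) ?_
  intro T i j a b hab
  have : a = b := by
    have h : a ≫ 𝟙 X = b ≫ 𝟙 X := hab
    exact (Category.comp_id a).symm.trans (h.trans (Category.comp_id b))
  subst this
  exact ⟨0, trans_zero _ _, trans_zero _ _⟩

end GaScheme

lemma toPuncturedPlane_ι {T : Scheme.{0}} (t : T ⟶ SpecC) (a b : Γ(T, ⊤))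
    (hab : T.basicOpen a ⊔ T.basicOpen b = ⊤) :
    toPuncturedPlane t a b hab ≫ puncturedPlane.ι = AffineSpace.homOfVector t ![a, b] :=
  IsOpenImmersion.lift_fac _ _ _

/-! ### `SL₂` as a torsor over the punctured plane, and its pullbacks -/

namespace SL2

open GaScheme

variable {T : Scheme.{0}}

lemma mul_unipotent_eq_iff {R : Type} [CommRing R] (M N : Matrix.SpecialLinearGroup (Fin 2) R)
    (h₀ : M 0 0 = N 0 0) (h₁ : M 1 0 = N 1 0) (c : R) :
    M * unipotent c = N ↔ M 0 1 + c * M 0 0 = N 0 1 ∧ M 1 1 + c * M 1 0 = N 1 1 := by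
  have e : ∀ i, (M * unipotent c) i 1 = M i 1 + c * M i 0 := by
    intro i
    rw [Matrix.SpecialLinearGroup.coe_mul, Matrix.mul_apply, Fin.sum_univ_two]
    simp only [unipotent, Matrix.of_apply, Matrix.cons_val', Matrix.cons_val_zero,
      Matrix.cons_val_one, Matrix.cons_val_fin_one]
    ring
  rw [← e, ← e]
  refine ⟨fun h => by rw [h]; exact ⟨rfl, rfl⟩, fun h => ?_⟩
  ext i j
  fin_cases i <;> fin_cases j
  · exact (mul_unipotent_apply_zero M c 0).trans h₀
  · exact h.1
  · exact (mul_unipotent_apply_zero M c 1).trans h₁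
  · exact h.2

/-- Both second columns complete the same first column to determinant one, so they differ by a
multiple of it. The multiple is, up to sign, the determinant formed by the two second columns. -/
lemma existsUnique_mul_unipotent {R : Type} [CommRing R]
    (M N : Matrix.SpecialLinearGroup (Fin 2) R) (h₀ : M 0 0 = N 0 0) (h₁ : M 1 0 = N 1 0) :
    ∃! c : R, M * unipotent c = N := by
  have hM : M 0 0 * M 1 1 - M 0 1 * M 1 0 = 1 := by
    rw [← Matrix.det_fin_two]
    exact M.det_coe
  have hN : N 0 0 * N 1 1 - N 0 1 * N 1 0 = 1 := by
    rw [← Matrix.det_fin_two]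
    exact N.det_coe
  rw [← h₀, ← h₁] at hN
  simp only [mul_unipotent_eq_iff M N h₀ h₁]
  refine ⟨M 1 1 * N 0 1 - M 0 1 * N 1 1, ⟨?_, ?_⟩, ?_⟩
  · linear_combination N 0 1 * hM - M 0 1 * hN
  · linear_combination N 1 1 * hM - M 1 1 * hN
  · rintro c ⟨h, h'⟩
    linear_combination M 1 1 * h - M 0 1 * h' - c * hM

lemma homOfVector_pair_inj {t t' : T ⟶ SpecC} {a b a' b' : Γ(T, ⊤)}
    (h : AffineSpace.homOfVector t ![a, b] = AffineSpace.homOfVector t' ![a', b']) :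
    t = t' ∧ a = a' ∧ b = b' := by
  refine ⟨?_, ?_, ?_⟩
  · rw [← AffineSpace.homOfVector_over t ![a, b], h, AffineSpace.homOfVector_over]
  · have := AffineSpace.homOfVector_appTop_coord t ![a, b] 0
    rw [h, AffineSpace.homOfVector_appTop_coord] at this
    exact this.symm
  · have := AffineSpace.homOfVector_appTop_coord t ![a, b] 1
    rw [h, AffineSpace.homOfVector_appTop_coord] at this
    exact this.symm

lemma eq_of_comp_proj_eq {p q : T ⟶ SL2} (h : p ≫ proj = q ≫ proj) :
    p ≫ toSpecC = q ≫ toSpecC ∧ matrix p 0 0 = matrix q 0 0 ∧ matrix p 1 0 = matrix q 1 0 := by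
  have := congrArg (· ≫ puncturedPlane.ι) h
  simp only [Category.assoc, comp_proj_ι] at this
  exact homOfVector_pair_inj this

lemma gaPoint_act_eq_iff {p q : T ⟶ SL2} (h : p ≫ proj = q ≫ proj) (c : Γ(T, ⊤)) :
    gaPoint p c ≫ act = q ↔ matrix p * unipotent c = matrix q := by
  rw [← matrix_gaPoint_act]
  refine ⟨fun h => by rw [h], fun h' => hom_ext ?_ h'⟩
  rw [gaPoint_act_toSpecC, (eq_of_comp_proj_eq h).1]

lemma isTorsor_bundle : bundle.IsTorsor := by
  intro T p q h
  obtain ⟨-, h₀, h₁⟩ := eq_of_comp_proj_eq h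
  obtain ⟨c, hc, hc'⟩ := existsUnique_mul_unipotent _ _ h₀ h₁
  exact ⟨c, (gaPoint_act_eq_iff h c).mpr hc, fun d hd => hc' d ((gaPoint_act_eq_iff h d).mp hd)⟩

/-- The special linear matrix with the given entries. -/
def mk₂ {R : Type} [CommRing R] (g h y z : R) (e : g * z - h * y = 1) :
    Matrix.SpecialLinearGroup (Fin 2) R :=
  ⟨!![g, y; h, z], by rw [Matrix.det_fin_two_of, ← e, mul_comm h]⟩

variable {X : Scheme.{0}} (t : X ⟶ SpecC) (g h : Γ(X, ⊤))
  (hgh : X.basicOpen g ⊔ X.basicOpen h = ⊤)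

lemma ofMatrix_proj (e : T ⟶ X) (y z : Γ(T, ⊤))
    (he : e.appTop g * z - e.appTop h * y = 1) :
    e ≫ toPuncturedPlane t g h hgh = ofMatrix (e ≫ t) (mk₂ _ _ y z he) ≫ proj := by
  rw [← cancel_mono puncturedPlane.ι, Category.assoc, Category.assoc, comp_proj_ι,
    toPuncturedPlane_ι, AffineSpace.comp_homOfVector, ofMatrix_toSpecC, matrix_ofMatrix]
  congr 1
  funext i
  fin_cases i <;> rfl

/-- The point of the pullback of `SL₂` to `X` under `(g, h)` that corresponds to a second column. -/
def pullbackPoint (e : T ⟶ X) (y z : Γ(T, ⊤)) (he : e.appTop g * z - e.appTop h * y = 1) :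
    T ⟶ (bundle.pullback (toPuncturedPlane t g h hgh)).total :=
  bundle.pullbackLift _ e (ofMatrix (e ≫ t) (mk₂ _ _ y z he)) (ofMatrix_proj t g h hgh e y z he)

lemma pullbackPoint_proj (e : T ⟶ X) (y z : Γ(T, ⊤))
    (he : e.appTop g * z - e.appTop h * y = 1) :
    pullbackPoint t g h hgh e y z he ≫
      (bundle.pullback (toPuncturedPlane t g h hgh)).proj = e :=
  pullbackLift_proj _ _ _ _ _

lemma pullbackPoint_snd (e : T ⟶ X) (y z : Γ(T, ⊤))
    (he : e.appTop g * z - e.appTop h * y = 1) :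
    pullbackPoint t g h hgh e y z he ≫ bundle.pullbackSnd (toPuncturedPlane t g h hgh) =
      ofMatrix (e ≫ t) (mk₂ _ _ y z he) :=
  pullbackLift_snd bundle (toPuncturedPlane t g h hgh) _ (ofMatrix (e ≫ t) (mk₂ _ _ y z he))
    (ofMatrix_proj t g h hgh e y z he)

/-- In the pullback of `SL₂` the first column is fixed by the base point, so a translation is just
the addition of `c` times that column to the second. -/
lemma trans_pullbackPoint {T₁ T₂ : Scheme.{0}} (e₁ : T₁ ⟶ X) (y₁ z₁ : Γ(T₁, ⊤))
    (h₁ : e₁.appTop g * z₁ - e₁.appTop h * y₁ = 1) (e₂ : T₂ ⟶ X) (y₂ z₂ : Γ(T₂, ⊤))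
    (h₂ : e₂.appTop g * z₂ - e₂.appTop h * y₂ = 1) (a : T ⟶ T₁) (b : T ⟶ T₂)
    (hab : a ≫ e₁ = b ≫ e₂) (c : Γ(T, ⊤))
    (hy : a.appTop y₁ + c * (a ≫ e₁).appTop g = b.appTop y₂)
    (hz : a.appTop z₁ + c * (a ≫ e₁).appTop h = b.appTop z₂) :
    (bundle.pullback (toPuncturedPlane t g h hgh)).trans
      (a ≫ pullbackPoint t g h hgh e₁ y₁ z₁ h₁) c = b ≫ pullbackPoint t g h hgh e₂ y₂ z₂ h₂ := by
  rw [pullback_trans_eq_iff]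
  · rw [Category.assoc, Category.assoc, pullbackPoint_snd, pullbackPoint_snd]
    refine (gaPoint_act_eq_iff (p := a ≫ ofMatrix (e₁ ≫ t) _) (q := b ≫ ofMatrix (e₂ ≫ t) _)
      ?_ c).mpr ?_
    · rw [Category.assoc, Category.assoc, ← ofMatrix_proj t g h hgh e₁,
        ← ofMatrix_proj t g h hgh e₂, ← Category.assoc, hab, Category.assoc]
    · rw [matrix_comp, matrix_comp, matrix_ofMatrix, matrix_ofMatrix, mul_unipotent_eq_iff]
      · constructor
        · rw [Scheme.Hom.comp_appTop] at hy
          exact hy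
        · rw [Scheme.Hom.comp_appTop] at hz
          exact hz
      · have := congrArg (fun q => Scheme.Hom.appTop q g) hab
        simp only [Scheme.Hom.comp_appTop] at this
        exact this
      · have := congrArg (fun q => Scheme.Hom.appTop q h) hab
        simp only [Scheme.Hom.comp_appTop] at this
        exact this
  · rw [Category.assoc, Category.assoc, pullbackPoint_proj, pullbackPoint_proj, hab]

/-- A torsor is a pullback of `SL₂` if its cocycle splits in a suitable extension of the structure
sheaf by itself. -/
lemma nonempty_iso_pullback {P : GaScheme X} (hP : P.IsTorsor) (𝒰 : Scheme.OpenCover.{0} X)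
    (σ : ∀ i, 𝒰.X i ⟶ P.total) (hσ : ∀ i, σ i ≫ P.proj = 𝒰.f i) (y z : ∀ i, Γ(𝒰.X i, ⊤))
    (hyz : ∀ i, (𝒰.f i).appTop g * z i - (𝒰.f i).appTop h * y i = 1)
    (H : ∀ (T : Scheme.{0}) (i j) (a : T ⟶ 𝒰.X i) (b : T ⟶ 𝒰.X j), a ≫ 𝒰.f i = b ≫ 𝒰.f j →
      ∃ c, P.trans (a ≫ σ i) c = b ≫ σ j ∧ a.appTop (y i) + c * (a ≫ 𝒰.f i).appTop g =
        b.appTop (y j) ∧ a.appTop (z i) + c * (a ≫ 𝒰.f i).appTop h = b.appTop (z j)) :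
    Nonempty (P.Iso (bundle.pullback (toPuncturedPlane t g h hgh))) := by
  refine nonempty_iso_of_sections hP (isTorsor_bundle.pullback _) 𝒰 σ
    (fun i => pullbackPoint t g h hgh (𝒰.f i) (y i) (z i) (hyz i)) hσ
    (fun i => pullbackPoint_proj _ _ _ _ _ _ _ _) ?_
  intro T i j a b hab
  obtain ⟨c, hc, hy, hz⟩ := H T i j a b hab
  exact ⟨c, hc, trans_pullbackPoint _ _ _ _ _ _ _ _ _ _ _ _ _ _ hab c hy hz⟩

end SL2

/-! ### Sections over open subsets, their differences, and averaging -/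

section resFun

variable {S : Scheme.{0}} {U V W : S.Opens}

/-- Restriction of functions to a smaller open subset. -/
def resFun (e : V ≤ U) : Γ(S, U) →+* Γ(S, V) := (S.presheaf.map (homOfLE e).op).hom

lemma resFun_resFun (e : V ≤ U) (e' : W ≤ V) (c : Γ(S, U)) :
    resFun e' (resFun e c) = resFun (e'.trans e) c := by
  rw [resFun, resFun, resFun, ← CommRingCat.comp_apply, ← Functor.map_comp, ← op_comp]
  rfl

lemma resFun_injective [IsIntegral S] (e : V ≤ U) (hV : (V : Set S).Nonempty) :
    Function.Injective (resFun e) := by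
  have : Nonempty V := hV.to_subtype
  exact map_injective_of_isIntegral S (homOfLE e)

lemma basicOpen_resFun (e : V ≤ U) (c : Γ(S, U)) :
    S.basicOpen (resFun e c) = V ⊓ S.basicOpen c :=
  S.basicOpen_res c (homOfLE e).op

lemma topIso_inv_comp_homOfLE_appTop (e : V ≤ U) : U.topIso.inv ≫ (S.homOfLE e).appTop =
    S.presheaf.map (homOfLE e).op ≫ V.topIso.inv := by
  rw [Scheme.homOfLE_appTop, Scheme.Opens.topIso_inv, Scheme.Opens.topIso_inv]
  exact (S.presheaf.map_comp _ _).symm.trans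
    (S.presheaf.map_comp (homOfLE e).op (eqToHom V.ι_image_top).op)

lemma appTop_homOfLE_topIso_inv (e : V ≤ U) (c : Γ(S, U)) :
    (S.homOfLE e).appTop (U.topIso.inv c) = V.topIso.inv (resFun e c) :=
  congrArg (fun q => q.hom c) (topIso_inv_comp_homOfLE_appTop e)

end resFun

lemma exists_lift_inf {S T : Scheme.{0}} {U V : S.Opens} (a : T ⟶ U.toScheme)
    (b : T ⟶ V.toScheme) (h : a ≫ U.ι = b ≫ V.ι) : ∃ e : T ⟶ (U ⊓ V).toScheme,
      e ≫ S.homOfLE inf_le_left = a ∧ e ≫ S.homOfLE inf_le_right = b :=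
  ⟨(isPullback_opens_inf U V).lift a b h, (isPullback_opens_inf U V).lift_fst _ _ _,
    (isPullback_opens_inf U V).lift_snd _ _ _⟩

namespace GaScheme

variable {S : Scheme.{0}}

/-- Sections of a scheme with `𝔾ₐ`-action over an open subset of the base. -/
@[ext]
structure Sec (Q : GaScheme S) (W : S.Opens) where
  /-- the underlying morphism -/
  hom : W.toScheme ⟶ Q.total
  hom_proj : hom ≫ Q.proj = W.ι

namespace Sec

variable {Q : GaScheme S} {U V W : S.Opens}

/-- Restriction of sections to a smaller open subset. -/
def res (e : V ≤ W) (σ : Q.Sec W) : Q.Sec V where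
  hom := S.homOfLE e ≫ σ.hom
  hom_proj := by rw [Category.assoc, σ.hom_proj, Scheme.homOfLE_ι]

lemma res_hom (e : V ≤ W) (σ : Q.Sec W) : (σ.res e).hom = S.homOfLE e ≫ σ.hom := rfl

/-- Translation of a section by a function. -/
def add (σ : Q.Sec W) (c : Γ(S, W)) : Q.Sec W where
  hom := Q.trans σ.hom (W.topIso.inv c)
  hom_proj := by rw [trans_proj, σ.hom_proj]

lemma add_hom (σ : Q.Sec W) (c : Γ(S, W)) :
    (σ.add c).hom = Q.trans σ.hom (W.topIso.inv c) := rfl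

lemma add_add (σ : Q.Sec W) (c d : Γ(S, W)) : (σ.add c).add d = σ.add (c + d) := by
  ext1
  rw [add_hom, add_hom, add_hom, map_add, trans_trans]

lemma res_res (e : V ≤ W) (e' : U ≤ V) (σ : Q.Sec W) :
    (σ.res e).res e' = σ.res (e'.trans e) := by
  ext1
  rw [res_hom, res_hom, res_hom, ← Category.assoc, Scheme.homOfLE_homOfLE]

lemma res_add (e : V ≤ W) (σ : Q.Sec W) (c : Γ(S, W)) :
    (σ.add c).res e = (σ.res e).add (resFun e c) := by
  ext1
  rw [res_hom, add_hom, add_hom, res_hom, comp_trans, appTop_homOfLE_topIso_inv]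

lemma existsUnique_add_eq (hQ : Q.IsTorsor) (σ τ : Q.Sec W) : ∃! c, σ.add c = τ := by
  obtain ⟨c, hc, hc'⟩ := hQ σ.hom τ.hom (σ.hom_proj.trans τ.hom_proj.symm)
  have key : ∀ c, W.topIso.inv (W.topIso.hom c) = c := fun c => by
    rw [← CommRingCat.comp_apply, W.topIso.hom_inv_id]
    rfl
  have key' : ∀ c, W.topIso.hom (W.topIso.inv c) = c := fun c => by
    rw [← CommRingCat.comp_apply, W.topIso.inv_hom_id]
    rfl
  refine ⟨W.topIso.hom c, ?_, fun d hd => ?_⟩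
  · ext1
    rw [add_hom, key]
    exact hc
  · rw [← hc' (W.topIso.inv d) (congrArg hom hd), key']

/-- The difference of two sections. -/
def sub (hQ : Q.IsTorsor) (τ σ : Q.Sec W) : Γ(S, W) := (existsUnique_add_eq hQ σ τ).choose

lemma add_sub (hQ : Q.IsTorsor) (σ τ : Q.Sec W) : σ.add (sub hQ τ σ) = τ :=
  (existsUnique_add_eq hQ σ τ).choose_spec.1

lemma sub_eq_of_add_eq (hQ : Q.IsTorsor) {σ τ : Q.Sec W} {c : Γ(S, W)} (h : σ.add c = τ) :
    sub hQ τ σ = c :=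
  (existsUnique_add_eq hQ σ τ).unique (add_sub hQ σ τ) h

lemma res_sub (hQ : Q.IsTorsor) (σ τ : Q.Sec W) (e : V ≤ W) :
    resFun e (sub hQ τ σ) = sub hQ (τ.res e) (σ.res e) := by
  symm
  apply sub_eq_of_add_eq
  rw [← res_add, add_sub]

lemma sub_add_sub (hQ : Q.IsTorsor) (σ τ υ : Q.Sec W) :
    sub hQ υ τ + sub hQ τ σ = sub hQ υ σ := by
  symm
  apply sub_eq_of_add_eq
  rw [add_comm, ← add_add, add_sub, add_sub]

lemma exists_glue {ι : Type} (V : ι → S.Opens) (σ : ∀ i, Q.Sec (V i))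
    (h : ∀ i j, (σ i).res (inf_le_left : V i ⊓ V j ≤ V i) = (σ j).res inf_le_right) :
    Nonempty (Q.Sec (⨆ i, V i)) := by
  obtain ⟨F, hF⟩ : ∃ F : (⨆ i, V i).toScheme ⟶ Q.total,
      ∀ i, S.homOfLE (le_iSup V i) ≫ F = (σ i).hom := by
    refine ⟨Scheme.Cover.glueMorphisms (Scheme.Opens.iSupOpenCover V) (fun i => (σ i).hom) ?_,
      fun i => Scheme.Cover.ι_glueMorphisms (Scheme.Opens.iSupOpenCover V) _ _ i⟩
    have key : ∀ (T : Scheme.{0}) (i j) (a : T ⟶ (V i).toScheme) (b : T ⟶ (V j).toScheme),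
        a ≫ S.homOfLE (le_iSup V i) = b ≫ S.homOfLE (le_iSup V j) →
          a ≫ (σ i).hom = b ≫ (σ j).hom := by
      intro T i j a b hab
      have hab' : a ≫ (V i).ι = b ≫ (V j).ι := by
        rw [← Scheme.homOfLE_ι S (le_iSup V i), ← Scheme.homOfLE_ι S (le_iSup V j),
          ← Category.assoc, hab, Category.assoc]
      obtain ⟨e, rfl, rfl⟩ := exists_lift_inf a b hab'
      have := congrArg hom (h i j)
      rw [Category.assoc, Category.assoc]
      exact congrArg (e ≫ ·) this
    exact fun i j => key _ i j _ _ pullback.condition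
  refine ⟨F, Scheme.Cover.hom_ext (Scheme.Opens.iSupOpenCover V) _ _ ?_⟩
  have : ∀ i, S.homOfLE (le_iSup V i) ≫ F ≫ Q.proj = S.homOfLE (le_iSup V i) ≫ (⨆ i, V i).ι := by
    intro i
    rw [← Category.assoc, hF, (σ i).hom_proj, Scheme.homOfLE_ι]
  exact this

/-- The section over the image of an open immersion. -/
lemma nonempty_opensRange {Z : Scheme.{0}} (k : Z ⟶ S) [IsOpenImmersion k] (σ : Z ⟶ Q.total)
    (hσ : σ ≫ Q.proj = k) : Nonempty (Q.Sec k.opensRange) := by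
  have hr : Set.range k.opensRange.ι ⊆ Set.range k := by
    rw [Scheme.Opens.range_ι]
    rfl
  exact ⟨IsOpenImmersion.lift k k.opensRange.ι hr ≫ σ, by
    rw [Category.assoc, hσ, IsOpenImmersion.lift_fac]⟩

/-- Allowing all exponents from some `n` on lets finitely many functions be extended with one common
exponent. -/
lemma exists_pow_mul_eq_resFun [IsNoetherian S] (f : Γ(S, W)) (hV : V = S.basicOpen f)
    (e : V ≤ W) (c : Γ(S, V)) :
    ∃ n, ∀ m, n ≤ m → ∃ d : Γ(S, W), resFun e d = resFun e f ^ m * c := by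
  subst hV
  obtain ⟨n, y, hy⟩ := exists_eq_pow_mul_of_isCompact_of_isQuasiSeparated S W
    (TopologicalSpace.NoetherianSpace.isCompact _) (.of_quasiSeparatedSpace _) f c
  have hy' : resFun e y = resFun e f ^ n * c := hy
  refine ⟨n, fun m hm => ⟨f ^ (m - n) * y, ?_⟩⟩
  rw [map_mul, map_pow, hy', ← mul_assoc, ← pow_add, Nat.sub_add_cancel hm]

/-- Averaging of sections over a cover by principal open subsets. -/
lemma nonempty_of_span_eq_top [IsIntegral S] [IsNoetherian S] (hQ : Q.IsTorsor)
    (h : Ideal.span {f : Γ(S, W) | Nonempty (Q.Sec (S.basicOpen f))} = ⊤) :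
    Nonempty (Q.Sec W) := by
  -- Discarding `0` makes all principal opens nonempty, so that restriction to their intersections
  -- is injective.
  have h' : Ideal.span ({f : Γ(S, W) | Nonempty (Q.Sec (S.basicOpen f))} \ {0}) = ⊤ := by
    rw [Ideal.span_sdiff_singleton_zero, h]
  obtain ⟨t, ht, ht'⟩ := (Ideal.span_eq_top_iff_finite _).mp h'
  have hne : ∀ f : t, f.1 ≠ 0 := fun f => (ht f.2).2
  let σ : ∀ f : t, Q.Sec (S.basicOpen f.1) := fun f => (ht f.2).1.some
  let D : t → S.Opens := fun f => S.basicOpen f.1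
  have hDW : ∀ i, D i ≤ W := fun i => S.basicOpen_le _
  have hD : ∀ i, (D i : Set S).Nonempty := by
    intro i
    rw [Set.nonempty_iff_ne_empty]
    intro he
    have : D i = ⊥ := TopologicalSpace.Opens.ext he
    exact hne i ((basicOpen_eq_bot_iff _).mp this)
  let c : ∀ i j : t, Γ(S, D j ⊓ D i) := fun i j =>
    sub hQ ((σ i).res inf_le_right) ((σ j).res inf_le_left)
  have hext : ∀ i j, ∃ n, ∀ m, n ≤ m → ∃ d : Γ(S, D j),
      resFun inf_le_left d = resFun (inf_le_right.trans (hDW i)) i.1 ^ m * c i j := by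
    intro i j
    obtain ⟨n, hn⟩ := exists_pow_mul_eq_resFun (V := D j ⊓ D i) (resFun (hDW j) i.1)
      (basicOpen_resFun (hDW j) i.1).symm inf_le_left (c i j)
    refine ⟨n, fun m hm => ?_⟩
    obtain ⟨d, hd⟩ := hn m hm
    exact ⟨d, by rw [hd, resFun_resFun]⟩
  choose n hn using hext
  let N := Finset.univ.sup fun i => Finset.univ.sup fun j => n i j
  have hN : ∀ i j, n i j ≤ N := fun i j =>
    (Finset.le_sup (f := fun j => n i j) (Finset.mem_univ j)).trans
      (Finset.le_sup (f := fun i => Finset.univ.sup fun j => n i j) (Finset.mem_univ i))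
  choose d hd using fun i j => hn i j N (hN i j)
  have hspan : Ideal.span (Set.range fun i : t => i.1 ^ N) = ⊤ := by
    convert Ideal.span_pow_eq_top _ ht' N using 2
    ext y
    simp
  obtain ⟨a, ha⟩ := (Ideal.mem_span_range_iff_exists_fun).mp
    (hspan ▸ Submodule.mem_top (x := (1 : Γ(S, W))))
  have hcov : ⨆ i, D i = W := by
    exact (iSup_subtype (p := fun f => f ∈ t) (f := fun f => S.basicOpen f.1)).trans
      (iSup_basicOpen_of_span_eq_top W (t : Set Γ(S, W)) ht')
  refine hcov ▸ ?_
  -- Since `d i j` extends `f_i^N (σ_i - σ_j)` and `∑ a_i f_i^N = 1`, the corrected section is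
  -- formally `∑ a_i f_i^N σ_i`, which does not depend on `j`.
  refine exists_glue D (fun j => (σ j).add (∑ i, resFun (hDW j) (a i) * d i j)) fun j k => ?_
  rw [res_add, res_add]
  have hjk : (σ j).res (inf_le_left : D j ⊓ D k ≤ D j) = ((σ k).res inf_le_right).add
      (sub hQ ((σ j).res inf_le_left) ((σ k).res inf_le_right)) := (add_sub hQ _ _).symm
  rw [hjk, add_add]
  congr 1
  set γ := sub hQ ((σ j).res (inf_le_left : D j ⊓ D k ≤ D j)) ((σ k).res inf_le_right) with hγ
  have hWjk : D j ⊓ D k ≤ W := inf_le_left.trans (hDW j)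
  -- On `D i ⊓ D j ⊓ D k` this is additivity of differences; by integrality it holds on all of `D j
  -- ⊓ D k`.
  have hdd : ∀ i, resFun inf_le_right (d i k) =
      resFun inf_le_left (d i j) + resFun hWjk (i.1 ^ N) * γ := by
    intro i
    have l₁ : D i ⊓ (D j ⊓ D k) ≤ D j ⊓ D k := inf_le_right
    have l₂ : D i ⊓ (D j ⊓ D k) ≤ D k ⊓ D i := le_inf (l₁.trans inf_le_right) inf_le_left
    have l₃ : D i ⊓ (D j ⊓ D k) ≤ D j ⊓ D i := le_inf (l₁.trans inf_le_left) inf_le_left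
    have hne3 : ((D i ⊓ (D j ⊓ D k) : S.Opens) : Set S).Nonempty :=
      nonempty_preirreducible_inter (D i).2 (D j ⊓ D k).2 (hD i)
        (nonempty_preirreducible_inter (D j).2 (D k).2 (hD j) (hD k))
    apply resFun_injective l₁ hne3
    have e₁ := congrArg (resFun l₂) (hd i k)
    have e₂ := congrArg (resFun l₃) (hd i j)
    rw [map_mul, map_pow, resFun_resFun, resFun_resFun] at e₁ e₂
    rw [map_add, map_mul, resFun_resFun, resFun_resFun, resFun_resFun, e₁, e₂, map_pow, ← mul_add]
    congr 1
    rw [res_sub, res_sub, res_sub, res_res, res_res, res_res, res_res, res_res, res_res,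
      sub_add_sub]
  have ha' := congrArg (resFun hWjk) ha
  rw [map_sum, map_one] at ha'
  simp only [map_mul] at ha'
  rw [map_sum, map_sum]
  simp only [map_mul, resFun_resFun, hdd, mul_add, Finset.sum_add_distrib]
  rw [add_comm]
  congr 1
  conv_lhs => rw [← one_mul γ, ← ha', Finset.sum_mul]
  simp only [mul_assoc]

end Sec

end GaScheme

/-! ### Triviality over affine opens and excision -/

namespace GaScheme

variable {X Y : Scheme.{0}}

/-- The composite of the projection with a morphism out of the base. -/
def pushforward (P : GaScheme X) (j : X ⟶ Y) : GaScheme Y where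
  total := P.total
  proj := P.proj ≫ j
  act := P.act
  act_proj := by rw [← Category.assoc, P.act_proj, Category.assoc]
  act_zero := P.act_zero
  act_add := P.act_add

lemma IsTorsor.pushforward {P : GaScheme X} (hP : P.IsTorsor) (j : X ⟶ Y) [Mono j] :
    (P.pushforward j).IsTorsor := by
  have key : ∀ {T : Scheme.{0}} {p q : T ⟶ P.total}, p ≫ P.proj ≫ j = q ≫ P.proj ≫ j →
      p ≫ P.proj = q ≫ P.proj := by
    intro T p q h
    rwa [← Category.assoc, ← Category.assoc, cancel_mono] at h
  exact fun T p q h => hP p q (key h)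

variable {S : Scheme.{0}} {V W : S.Opens}

/-- The underlying morphism to the total space of a section of a pushforward. -/
def Sec.toHom {P : GaScheme V.toScheme} (σ : (P.pushforward V.ι).Sec W) :
    W.toScheme ⟶ P.total := σ.hom

lemma Sec.toHom_comp_proj {P : GaScheme V.toScheme} (σ : (P.pushforward V.ι).Sec W) (e : W ≤ V) :
    σ.toHom ≫ P.proj = S.homOfLE e := by
  have h : σ.toHom ≫ P.proj ≫ V.ι = W.ι := σ.hom_proj
  rw [← cancel_mono V.ι, Scheme.homOfLE_ι, Category.assoc]
  exact h

lemma IsTorsor.isTrivial_of_sec {P : GaScheme V.toScheme} (hP : P.IsTorsor)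
    (σ : (P.pushforward V.ι).Sec V) : P.IsTrivial :=
  hP.isTrivial σ.toHom (by rw [σ.toHom_comp_proj le_rfl, Scheme.homOfLE_rfl])

lemma IsPrincipalBundle.exists_sec {P : GaScheme V.toScheme} (hP : P.IsPrincipalBundle) {y : S}
    (hy : y ∈ V) : ∃ W : S.Opens, y ∈ W ∧ Nonempty ((P.pushforward V.ι).Sec W) := by
  obtain ⟨W, hW, ⟨e⟩⟩ := hP ⟨y, hy⟩
  let z : W.toScheme ⟶ (trivial W.toScheme).total := gaPoint (𝟙 _) 0
  have hz : z ≫ (trivial W.toScheme).proj = 𝟙 _ := gaPoint_over _ _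
  have he : e.iso.inv ≫ (P.pullback W.ι).proj = (trivial W.toScheme).proj := by
    rw [← e.hom_proj, Iso.inv_hom_id_assoc]
  refine ⟨(W.ι ≫ V.ι).opensRange, ⟨⟨⟨y, hy⟩, hW⟩, rfl⟩,
    Sec.nonempty_opensRange (W.ι ≫ V.ι) (z ≫ e.iso.inv ≫ P.pullbackSnd W.ι) ?_⟩
  change (z ≫ e.iso.inv ≫ P.pullbackSnd W.ι) ≫ P.proj ≫ V.ι = W.ι ≫ V.ι
  rw [Category.assoc, Category.assoc, ← Category.assoc (P.pullbackSnd _), pullbackSnd_proj,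
    Category.assoc, ← Category.assoc e.iso.inv, he, ← Category.assoc, hz, Category.id_comp]

/-- This plays the role of the vanishing of `H¹(W, 𝒪)`: principal opens of `W` carrying a section
cover `W`, so their functions generate the unit ideal and the sections can be averaged. -/
lemma IsPrincipalBundle.nonempty_sec_of_isAffineOpen [IsIntegral S] [IsNoetherian S]
    {P : GaScheme V.toScheme} (hP : P.IsPrincipalBundle) (hW : IsAffineOpen W) (hWV : W ≤ V) :
    Nonempty ((P.pushforward V.ι).Sec W) := by
  apply Sec.nonempty_of_span_eq_top (hP.isTorsor.pushforward _)
  rw [← hW.iSup_basicOpen_eq_self_iff]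
  refine le_antisymm (iSup_le fun f => S.basicOpen_le _) fun y hy => ?_
  obtain ⟨V', hyV', ⟨σ⟩⟩ := hP.exists_sec (hWV hy)
  obtain ⟨f, hf, hyf⟩ := hW.exists_basicOpen_le ⟨y, hyV'⟩ hy
  exact TopologicalSpace.Opens.mem_iSup.mpr ⟨⟨f, ⟨σ.res hf⟩⟩, hyf⟩

/-- Excision: a principal bundle on the punctured scheme that is trivial near the puncture is
trivial. -/
lemma IsPrincipalBundle.isTrivial_of_sec_inf [IsAffine S] [IsIntegral S] [IsNoetherian S] {x : S}
    {hx : IsClosed {x}} {P : GaScheme (puncture x hx).toScheme} (hP : P.IsPrincipalBundle)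
    {U : S.Opens} (hxU : x ∈ U)
    (σ : (P.pushforward (puncture x hx).ι).Sec (U ⊓ puncture x hx)) : P.IsTrivial := by
  let e : puncture x hx ≤ ⊤ := le_top
  have hspan : Ideal.span {f : Γ(S, ⊤) |
      Nonempty ((P.pushforward (puncture x hx).ι).Sec (S.basicOpen (resFun e f)))} = ⊤ := by
    rw [← (isAffineOpen_top S).iSup_basicOpen_eq_self_iff]
    refine le_antisymm le_top fun y _ => ?_
    -- Near `x` choose `D(f)` inside `U`, where `σ` is available; away from `x` choose `D(f)` inside
    -- the puncture, where it is affine.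
    by_cases hyx : y = x
    · subst hyx
      obtain ⟨f, hf, hyf⟩ := (isAffineOpen_top S).exists_basicOpen_le ⟨y, hxU⟩ True.intro
      refine TopologicalSpace.Opens.mem_iSup.mpr ⟨⟨f, ⟨σ.res ?_⟩⟩, hyf⟩
      rw [basicOpen_resFun]
      exact le_inf (inf_le_right.trans hf) inf_le_left
    · obtain ⟨f, hf, hyf⟩ := (isAffineOpen_top S).exists_basicOpen_le
        (V := puncture x hx) ⟨y, hyx⟩ True.intro
      refine TopologicalSpace.Opens.mem_iSup.mpr ⟨⟨f, ?_⟩, hyf⟩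
      change Nonempty (Sec _ (S.basicOpen (resFun e f)))
      rw [basicOpen_resFun, inf_eq_right.mpr hf]
      exact hP.nonempty_sec_of_isAffineOpen ((isAffineOpen_top S).basicOpen f) hf
  -- The puncture need not be affine, but averaging only needs the unit ideal, and this passes from
  -- `S` to the puncture by restriction.
  have hspan' := congrArg (Ideal.map (resFun e)) hspan
  rw [Ideal.map_span, Ideal.map_top] at hspan'
  have : Nonempty ((P.pushforward (puncture x hx).ι).Sec (puncture x hx)) := by
    apply Sec.nonempty_of_span_eq_top (hP.isTorsor.pushforward _)
    rw [eq_top_iff, ← hspan']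
    apply Ideal.span_mono
    rintro _ ⟨f, hf, rfl⟩
    exact hf
  exact hP.isTorsor.isTrivial_of_sec this.some

end GaScheme

/-! ### Coordinates in the extension attached to a torsor -/

/-- The open cover of an open subscheme by smaller open subschemes. -/
def coverOfLE {S : Scheme.{0}} {ι : Type} (W : S.Opens) (V : ι → S.Opens) (hV : ∀ i, V i ≤ W)
    (h : W ≤ ⨆ i, V i) : Scheme.OpenCover.{0} W.toScheme :=
  Scheme.Cover.mkOfCovers ι (fun i => (V i).toScheme) (fun i => S.homOfLE (hV i)) (by
    intro y
    obtain ⟨i, hi⟩ := TopologicalSpace.Opens.mem_iSup.mp (h y.2)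
    refine ⟨i, ⟨y.1, hi⟩, Subtype.ext ?_⟩
    rw [Scheme.homOfLE_apply]) (fun _ => inferInstance)

namespace GaScheme

variable {S : Scheme.{0}} {ι : Type}

namespace Sec

variable {Q : GaScheme S} {U W : S.Opens} (hQ : Q.IsTorsor) {V : ι → S.Opens}
  (σ : ∀ i, Q.Sec (V i))

/-- The functions `w i` transform as the coordinates of a section of the extension of the structure
sheaf by itself over `k` whose cocycle is that of the sections `σ i`. -/
def IsTwisted (k : Γ(S, U)) (hV : ∀ i, V i ≤ U) (w : ∀ i, Γ(S, V i)) : Prop :=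
  ∀ i j (W : S.Opens) (hi : W ≤ V i) (hj : W ≤ V j),
    resFun hi (w i) + sub hQ ((σ j).res hj) ((σ i).res hi) * resFun (hi.trans (hV i)) k =
      resFun hj (w j)

lemma sub_self (σ : Q.Sec W) : sub hQ σ σ = 0 := by
  have := sub_add_sub hQ σ σ σ
  simpa using this

lemma sub_comm (σ τ : Q.Sec W) : sub hQ σ τ = - sub hQ τ σ := by
  have := sub_add_sub hQ σ τ σ
  rw [sub_self] at this
  exact eq_neg_of_add_eq_zero_left this

lemma isTwisted_bool {V : Bool → S.Opens} {σ : ∀ i, Q.Sec (V i)} {k : Γ(S, U)}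
    {hV : ∀ i, V i ≤ U} {w : ∀ i, Γ(S, V i)}
    (h : ∀ (W : S.Opens) (hi : W ≤ V false) (hj : W ≤ V true),
      resFun hi (w false) + sub hQ ((σ true).res hj) ((σ false).res hi) *
        resFun (hi.trans (hV false)) k = resFun hj (w true)) :
    IsTwisted hQ σ k hV w := by
  rintro (_ | _) (_ | _) W hi hj
  · rw [sub_self, zero_mul, _root_.add_zero]
  · exact h W hi hj
  · rw [← h W hj hi, sub_comm, neg_mul, neg_add_cancel_right]
  · rw [sub_self, zero_mul, _root_.add_zero]

variable {σ}

/-- A section of the extension with invertible image `k` splits it: the functions `w i / k` have the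
`σ i` differences as coboundary, so the sections `σ i - w i / k` glue. -/
lemma IsTwisted.nonempty_sec {k : Γ(S, U)} {hV : ∀ i, V i ≤ U} {w : ∀ i, Γ(S, V i)}
    (h : IsTwisted hQ σ k hV w) (hk : IsUnit k) : Nonempty (Q.Sec (⨆ i, V i)) := by
  obtain ⟨e, he⟩ := hk.exists_left_inv
  refine exists_glue V (fun i => (σ i).add (-(resFun (hV i) e * w i))) fun i j => ?_
  have hij := h i j (V i ⊓ V j) inf_le_left inf_le_right
  have he' := congrArg (resFun (inf_le_left.trans (hV i) : V i ⊓ V j ≤ U)) he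
  rw [map_mul, map_one] at he'
  rw [res_add, res_add, ← add_sub hQ ((σ i).res inf_le_left) ((σ j).res inf_le_right), add_add]
  congr 1
  rw [map_neg, map_neg, map_mul, map_mul, resFun_resFun, resFun_resFun, ← hij]
  linear_combination sub hQ (res inf_le_right (σ j)) (res inf_le_left (σ i)) * he'

end Sec

/-- The pairs `(g, y)` and `(h, z)` are two sections of the extension forming a frame of determinant
one. Their coordinates supply second columns for `SL₂.nonempty_iso_pullback`, with the same
difference cocycle as the `σ i`. -/
lemma nonempty_iso_puncturedMap (s : S ⟶ SpecC) {x : S} {hx : IsClosed {x}}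
    {P : GaScheme (puncture x hx).toScheme} (hP : P.IsTorsor) {U : S.Opens} (g h : Γ(S, U))
    (hgh : IsOnlyCommonZero g h x) (V : ι → S.Opens) (hVU : ∀ i, V i ≤ U ⊓ puncture x hx)
    (hUV : U ⊓ puncture x hx ≤ ⨆ i, V i) (σ : ∀ i, (P.pushforward (puncture x hx).ι).Sec (V i))
    (y z : ∀ i, Γ(S, V i)) (hyz : ∀ i, resFun ((hVU i).trans inf_le_left) g * z i -
      resFun ((hVU i).trans inf_le_left) h * y i = 1)
    (hy : Sec.IsTwisted (hP.pushforward _) σ g (fun i => (hVU i).trans inf_le_left) y)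
    (hz : Sec.IsTwisted (hP.pushforward _) σ h (fun i => (hVU i).trans inf_le_left) z) :
    Nonempty ((P.pullback (S.homOfLE (inf_le_right : U ⊓ puncture x hx ≤ puncture x hx))).Iso
      (SL2.bundle.pullback (puncturedMap s x hx g h hgh))) := by
  have hσ : ∀ i, S.homOfLE (hVU i) ≫ S.homOfLE (inf_le_right : U ⊓ puncture x hx ≤ puncture x hx) =
      (σ i).toHom ≫ P.proj := by
    intro i
    rw [Scheme.homOfLE_homOfLE, (σ i).toHom_comp_proj]
  have hres : ∀ {W : S.Opens} (hW : W ≤ U) (hW' : W ≤ U ⊓ puncture x hx)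
      (k : Γ(S, U)), (S.homOfLE hW').appTop (restrictFun inf_le_left k) =
        W.topIso.inv (resFun hW k) := by
    intro W hW hW' k
    refine (appTop_homOfLE_topIso_inv hW' (resFun inf_le_left k)).trans ?_
    rw [resFun_resFun]
  refine SL2.nonempty_iso_pullback _ _ _ _ (hP.pullback _)
    (coverOfLE _ V hVU hUV)
    (fun i => P.pullbackLift _ (S.homOfLE (hVU i)) (σ i).toHom (hσ i))
    (fun i => P.pullbackLift_proj _ _ _ (hσ i))
    (fun i => (V i).topIso.inv (y i)) (fun i => (V i).topIso.inv (z i)) ?_ ?_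
  · intro i
    have := congrArg ((V i).topIso.inv) (hyz i)
    rw [map_sub, map_mul, map_mul, map_one, ← hres _ (hVU i), ← hres _ (hVU i)] at this
    exact this
  · have key : ∀ (T : Scheme.{0}) (i j) (a : T ⟶ (V i).toScheme) (b : T ⟶ (V j).toScheme),
        a ≫ S.homOfLE (hVU i) = b ≫ S.homOfLE (hVU j) → ∃ c,
          (P.pullback _).trans (a ≫ P.pullbackLift _ (S.homOfLE (hVU i)) (σ i).toHom (hσ i)) c =
            b ≫ P.pullbackLift _ (S.homOfLE (hVU j)) (σ j).toHom (hσ j) ∧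
          a.appTop ((V i).topIso.inv (y i)) + c *
            (a ≫ S.homOfLE (hVU i)).appTop (restrictFun inf_le_left g) =
              b.appTop ((V j).topIso.inv (y j)) ∧
          a.appTop ((V i).topIso.inv (z i)) + c *
            (a ≫ S.homOfLE (hVU i)).appTop (restrictFun inf_le_left h) =
              b.appTop ((V j).topIso.inv (z j)) := by
      intro T i j a b hab
      -- Both points factor through `V i ⊓ V j`, so the translating function is pulled back from the
      -- difference of sections there.
      obtain ⟨e, rfl, rfl⟩ := exists_lift_inf a b (by
        rw [← Scheme.homOfLE_ι S (hVU i), ← Category.assoc, hab, Category.assoc,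
          Scheme.homOfLE_ι])
      let c := Sec.sub (hP.pushforward (puncture x hx).ι)
        ((σ j).res (inf_le_right : V i ⊓ V j ≤ V j)) ((σ i).res inf_le_left)
      have tw : ∀ (k : Γ(S, U)) (w : ∀ i, Γ(S, V i)),
          Sec.IsTwisted (hP.pushforward _) σ k (fun i => (hVU i).trans inf_le_left) w →
          (e ≫ S.homOfLE (inf_le_left : V i ⊓ V j ≤ V i)).appTop ((V i).topIso.inv (w i)) +
            e.appTop ((V i ⊓ V j).topIso.inv c) *
              ((e ≫ S.homOfLE (inf_le_left : V i ⊓ V j ≤ V i)) ≫ S.homOfLE (hVU i)).appTop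
                (restrictFun inf_le_left k) =
          (e ≫ S.homOfLE (inf_le_right : V i ⊓ V j ≤ V j)).appTop ((V j).topIso.inv (w j)) := by
        intro k w hw
        have := congrArg (fun r => e.appTop ((V i ⊓ V j).topIso.inv r))
          (hw i j (V i ⊓ V j) inf_le_left inf_le_right)
        dsimp only at this
        rw [map_add, map_add, map_mul, map_mul, ← hres _ (inf_le_left.trans (hVU i)) k,
          ← appTop_homOfLE_topIso_inv inf_le_left (w i),
          ← appTop_homOfLE_topIso_inv inf_le_right (w j)] at this
        rw [Category.assoc, Scheme.homOfLE_homOfLE, Scheme.Hom.comp_appTop, Scheme.Hom.comp_appTop,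
          Scheme.Hom.comp_appTop]
        exact this
      refine ⟨e.appTop ((V i ⊓ V j).topIso.inv c), ?_, tw g y hy, tw h z hz⟩
      rw [pullback_trans_eq_iff]
      · have := congrArg (fun τ => e ≫ Sec.toHom τ)
          (Sec.add_sub (hP.pushforward (puncture x hx).ι)
            ((σ i).res (inf_le_left : V i ⊓ V j ≤ V i))
            ((σ j).res inf_le_right))
        have h' : e ≫ P.trans (S.homOfLE (inf_le_left : V i ⊓ V j ≤ V i) ≫ (σ i).toHom)
            ((V i ⊓ V j).topIso.inv c) =
            e ≫ S.homOfLE (inf_le_right : V i ⊓ V j ≤ V j) ≫ (σ j).toHom := this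
        rw [comp_trans] at h'
        simpa only [Category.assoc, pullbackLift_snd] using h'
      · simp only [Category.assoc, pullbackLift_proj, Scheme.homOfLE_homOfLE]
    exact key

end GaScheme

/-! ### Spreading out from the local ring of a point -/

namespace AlgebraicGeometry

variable {S : Scheme.{0}}

lemma germ_resFun {U V : S.Opens} (e : V ≤ U) (x : S) (hx : x ∈ V) (c : Γ(S, U)) :
    S.presheaf.germ V x hx (resFun e c) = S.presheaf.germ U x (e hx) c :=
  S.presheaf.germ_res_apply (homOfLE e) x hx c

lemma isUnit_resFun_basicOpen {U : S.Opens} (f : Γ(S, U)) :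
    IsUnit (resFun (S.basicOpen_le f) f) :=
  S.toRingedSpace.isUnit_res_basicOpen f

/-- Finitely many germs extend to a common affine open neighbourhood. -/
lemma exists_isAffineOpen_germ_eq (x : S) {F : Set (S.presheaf.stalk x)}
    (hF : F.Finite) (U₀ : S.Opens) (hx : x ∈ U₀) : ∃ (U : S.Opens) (hxU : x ∈ U),
      IsAffineOpen U ∧ U ≤ U₀ ∧ ∀ r ∈ F, ∃ c : Γ(S, U), S.presheaf.germ U x hxU c = r := by
  have : ∃ (U : S.Opens) (hxU : x ∈ U), U ≤ U₀ ∧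
      ∀ r ∈ F, ∃ c : Γ(S, U), S.presheaf.germ U x hxU c = r := by
    induction F, hF using Set.Finite.induction_on with
    | empty => exact ⟨U₀, hx, le_rfl, by simp⟩
    | @insert r F _ _ ih =>
      obtain ⟨U, hxU, hU, h⟩ := ih
      obtain ⟨V, hxV, c, hc⟩ := S.presheaf.exists_germ_eq r
      refine ⟨U ⊓ V, ⟨hxU, hxV⟩, inf_le_left.trans hU, ?_⟩
      rintro _ (rfl | hr)
      · exact ⟨resFun inf_le_right c, (germ_resFun inf_le_right x ⟨hxU, hxV⟩ c).trans hc⟩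
      · obtain ⟨d, rfl⟩ := h _ hr
        exact ⟨resFun inf_le_left d, germ_resFun _ _ _ _⟩
  obtain ⟨U, hxU, hU, h⟩ := this
  obtain ⟨_, ⟨V, hV, rfl⟩, hxV, hVU⟩ := S.isBasis_affineOpens.exists_subset_of_mem_open
    (show x ∈ (U : Set S) from hxU) U.2
  have hVU' : V ≤ U := hVU
  refine ⟨V, hxV, hV, hVU'.trans hU, fun r hr => ?_⟩
  obtain ⟨c, rfl⟩ := h r hr
  exact ⟨resFun hVU' c, germ_resFun _ _ _ _⟩

lemma ringKrullDim_stalk_le [IsAffine S] (x : S) :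
    ringKrullDim (S.presheaf.stalk x) ≤ topologicalKrullDim S := by
  have hloc := (isAffineOpen_top S).isLocalization_stalk ⟨x, trivial⟩
  let : Algebra Γ(S, ⊤) (S.presheaf.stalk x) :=
    TopCat.Presheaf.algebra_section_stalk S.presheaf (⟨x, trivial⟩ : (⊤ : S.Opens))
  have h := IsLocalization.AtPrime.ringKrullDim_eq_height
    ((isAffineOpen_top S).primeIdealOf ⟨x, trivial⟩).asIdeal (S.presheaf.stalk x)
  rw [h]
  refine (Ideal.height_le_ringKrullDim_of_ne_top (Ideal.IsPrime.ne_top inferInstance)).trans ?_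
  rw [← PrimeSpectrum.topologicalKrullDim_eq_ringKrullDim]
  exact (IsHomeomorph.topologicalKrullDim_eq _ S.isoSpec.hom.homeomorph.isHomeomorph).ge

/-- Generators of the maximal ideal of a closed point define the point in a neighbourhood. -/
lemma exists_puncture_eq_sup_basicOpen [IsAffine S] [IsIntegral S] [IsNoetherian S] (x : S)
    (hx : IsClosed {x}) {u v : S.presheaf.stalk x}
    (huv : IsLocalRing.maximalIdeal (S.presheaf.stalk x) = Ideal.span {u, v}) :
    ∃ (U : S.Opens) (hxU : x ∈ U) (u' v' : Γ(S, U)), IsAffineOpen U ∧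
      S.presheaf.germ U x hxU u' = u ∧ S.presheaf.germ U x hxU v' = v ∧
      U ⊓ puncture x hx = S.basicOpen u' ⊔ S.basicOpen v' := by
  -- Finitely many global functions vanishing at `x` already cut out `x`. Their germs are
  -- combinations of `u` and `v`, and on a neighbourhood where the coefficients extend, a common
  -- zero of `u'` and `v'` is a zero of them all.
  obtain ⟨t, ht⟩ := (TopologicalSpace.NoetherianSpace.isCompact
    (puncture x hx : Set S)).elim_finite_subcover
    (fun w : {w : Γ(S, ⊤) // x ∉ S.basicOpen w} => (S.basicOpen w.1 : Set S))
    (fun w => (S.basicOpen w.1).2) (fun y hy => by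
      obtain ⟨f, hf, hyf⟩ := (isAffineOpen_top S).exists_basicOpen_le
        (V := puncture x hx) ⟨y, hy⟩ trivial
      exact Set.mem_iUnion.mpr ⟨⟨f, fun h => hf h rfl⟩, hyf⟩)
  have hw : ∀ w : {w : Γ(S, ⊤) // x ∉ S.basicOpen w}, ∃ α β : S.presheaf.stalk x,
      α * u + β * v = S.presheaf.germ ⊤ x (TopologicalSpace.Opens.mem_top x) w.1 := by
    intro w
    rw [← Ideal.mem_span_pair, ← huv, IsLocalRing.mem_maximalIdeal, mem_nonunits_iff,
      ← Scheme.mem_basicOpen]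
    exact w.2
  choose α β hαβ using hw
  obtain ⟨U, hxU, hU, -, hlift⟩ := exists_isAffineOpen_germ_eq x
    (F := {u, v} ∪ (α '' t ∪ β '' t))
    ((Set.toFinite _).union ((t.finite_toSet.image α).union (t.finite_toSet.image β))) ⊤ trivial
  obtain ⟨u', hu'⟩ := hlift u (by simp)
  obtain ⟨v', hv'⟩ := hlift v (by simp)
  refine ⟨U, hxU, u', v', hU, hu', hv', le_antisymm ?_ ?_⟩
  · rintro y ⟨hyU, hyx⟩
    obtain ⟨w, hwt, hyw⟩ := Set.mem_iUnion₂.mp (ht hyx)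
    obtain ⟨α', hα⟩ := hlift (α w) (Or.inr (Or.inl ⟨w, hwt, rfl⟩))
    obtain ⟨β', hβ⟩ := hlift (β w) (Or.inr (Or.inr ⟨w, hwt, rfl⟩))
    have hrel : α' * u' + β' * v' = resFun le_top w.1 := by
      apply germ_injective_of_isIntegral S x hxU
      rw [germ_resFun, ← hαβ, map_add, map_mul, map_mul, hα, hβ, hu', hv']
    by_contra hy
    have h₁ : S.presheaf.germ U y hyU u' ∈ IsLocalRing.maximalIdeal (S.presheaf.stalk y) := by
      rw [IsLocalRing.mem_maximalIdeal, mem_nonunits_iff, ← Scheme.mem_basicOpen]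
      exact fun h => hy (Or.inl h)
    have h₂ : S.presheaf.germ U y hyU v' ∈ IsLocalRing.maximalIdeal (S.presheaf.stalk y) := by
      rw [IsLocalRing.mem_maximalIdeal, mem_nonunits_iff, ← Scheme.mem_basicOpen]
      exact fun h => hy (Or.inr h)
    have h₃ := congrArg (S.presheaf.germ U y hyU) hrel
    rw [germ_resFun, map_add, map_mul, map_mul] at h₃
    have h₄ : S.presheaf.germ ⊤ y (TopologicalSpace.Opens.mem_top y) w.1 ∈
        IsLocalRing.maximalIdeal (S.presheaf.stalk y) := by
      rw [← h₃]
      exact Ideal.add_mem _ (Ideal.mul_mem_left _ _ h₁) (Ideal.mul_mem_left _ _ h₂)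
    rw [IsLocalRing.mem_maximalIdeal, mem_nonunits_iff, ← Scheme.mem_basicOpen] at h₄
    exact h₄ hyw
  · have key : ∀ (r : Γ(S, U)), S.presheaf.germ U x hxU r ∈
        IsLocalRing.maximalIdeal (S.presheaf.stalk x) →
        S.basicOpen r ≤ U ⊓ puncture x hx := by
      intro r hr
      refine le_inf (S.basicOpen_le r) fun y hy hyx => ?_
      have hyx : y = x := hyx
      subst hyx
      rw [IsLocalRing.mem_maximalIdeal, mem_nonunits_iff, ← Scheme.mem_basicOpen] at hr
      exact hr hy
    refine sup_le (key _ ?_) (key _ ?_)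
    · rw [hu', huv]
      exact Ideal.subset_span (by simp)
    · rw [hv', huv]
      exact Ideal.subset_span (by simp)

end AlgebraicGeometry

/-! ### From syzygies to sections of the extension -/

namespace GaScheme

variable {S : Scheme.{0}} {Q : GaScheme S} {U : S.Opens} (hQ : Q.IsTorsor)

/-- The coordinates are `w i = Y i / f i ^ N`. As the two sections differ by `a / (f false * f true)
^ N`, multiplying the transformation rule by this denominator, a unit on the overlap, gives the
syzygy relation `hY`. -/
lemma Sec.exists_isTwisted {f : Bool → Γ(S, U)} (σ : ∀ i, Q.Sec (S.basicOpen (f i))) {N : ℕ}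
    {a b : Γ(S, U)} (Y : Bool → Γ(S, U))
    (hY : a * b + f true ^ N * Y false = f false ^ N * Y true)
    (h : ∀ (W : S.Opens) (hi : W ≤ S.basicOpen (f false)) (hj : W ≤ S.basicOpen (f true)),
      resFun (hi.trans (S.basicOpen_le _)) (f false * f true) ^ N *
        sub hQ ((σ true).res hj) ((σ false).res hi) = resFun (hi.trans (S.basicOpen_le _)) a) :
    ∃ w : ∀ i, Γ(S, S.basicOpen (f i)),
      (∀ i, resFun (S.basicOpen_le (f i)) (f i) ^ N * w i = resFun (S.basicOpen_le (f i)) (Y i)) ∧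
      IsTwisted hQ σ b (fun i => S.basicOpen_le (f i)) w := by
  choose e he using fun i => (isUnit_resFun_basicOpen (f i)).exists_right_inv
  have hw : ∀ i, resFun (S.basicOpen_le (f i)) (f i) ^ N *
      (e i ^ N * resFun (S.basicOpen_le (f i)) (Y i)) = resFun (S.basicOpen_le (f i)) (Y i) := by
    intro i
    rw [← mul_assoc, ← mul_pow, he, one_pow, one_mul]
  refine ⟨_, hw, isTwisted_bool hQ fun W hi hj => ?_⟩
  have hW : W ≤ U := hi.trans (S.basicOpen_le _)
  have hu : IsUnit (resFun hW (f false * f true) ^ N) := by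
    have h₁ := (isUnit_resFun_basicOpen (f false)).map (resFun hi)
    have h₂ := (isUnit_resFun_basicOpen (f true)).map (resFun hj)
    rw [resFun_resFun] at h₁ h₂
    rw [map_mul]
    exact (h₁.mul h₂).pow N
  have h₀ := congrArg (resFun hi) (hw false)
  have h₁ := congrArg (resFun hj) (hw true)
  have h₂ := congrArg (resFun hW) hY
  generalize e false ^ N * resFun (S.basicOpen_le (f false)) (Y false) = w₀ at *
  generalize e true ^ N * resFun (S.basicOpen_le (f true)) (Y true) = w₁ at *
  have h₃ := h W hi hj
  generalize sub hQ ((σ true).res hj) ((σ false).res hi) = c at *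
  apply hu.mul_left_cancel
  rw [map_mul, map_pow, resFun_resFun, resFun_resFun] at h₀ h₁
  simp only [map_add, map_mul, map_pow] at h₂ h₃ ⊢
  rw [mul_pow] at h₃ ⊢
  linear_combination (resFun hW (f true) ^ N) * h₀ + (resFun hW b) * h₃ + h₂ -
    (resFun hW (f false) ^ N) * h₁

end GaScheme

lemma IsNormalAffineSurface.isNoetherian {S : Scheme.{0}} {s : S ⟶ SpecC}
    (hS : IsNormalAffineSurface s) : IsNoetherian S := by
  have := hS.isAffine
  have := hS.locallyOfFiniteType
  have := LocallyOfFiniteType.isLocallyNoetherian s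
  exact {}

end

/-! ### The main theorem -/

theorem proposition3p1 (S : Scheme.{0}) (s : S ⟶ SpecC) (hS : IsNormalAffineSurface s)
    (x : S) (hx : IsClosed {x}) (hreg : IsRegularLocalRing (S.presheaf.stalk x))
    (P : GaScheme (puncture x hx).toScheme) (hP : P.IsPrincipalBundle) (hnt : ¬ P.IsTrivial) :
    ∃ (U : S.Opens) (g h : Γ(S, U)) (hgh : IsOnlyCommonZero g h x),
      x ∈ U ∧ IsAffineOpen U ∧
      Nonempty ((P.pullback (S.homOfLE (inf_le_right : U ⊓ puncture x hx ≤ puncture x hx))).Iso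
        (SL2.bundle.pullback (puncturedMap s x hx g h hgh))) := by
  have := hS.isAffine
  have := hS.isIntegral
  have := hS.isNoetherian
  have hQ : (P.pushforward (puncture x hx).ι).IsTorsor := hP.isTorsor.pushforward _
  have hnt' : ∀ {U : S.Opens} (_ : x ∈ U),
      ¬ Nonempty ((P.pushforward (puncture x hx).ι).Sec (U ⊓ puncture x hx)) :=
    fun hxU ⟨σ⟩ => hnt (hP.isTrivial_of_sec_inf hxU σ)
  obtain ⟨u, v, hm, hdim⟩ := IsLocalRing.exists_maximalIdeal_eq_span_pair
    ((ringKrullDim_stalk_le x).trans hS.dim_eq_two.le)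
  obtain ⟨U₀, hxU₀, u₀, v₀, hU₀, rfl, rfl, hpunc⟩ := exists_puncture_eq_sup_basicOpen x hx hm
  have hle : ∀ i : Bool, S.basicOpen (cond i v₀ u₀) ≤ puncture x hx := by
    intro i
    refine le_trans ?_ (hpunc.ge.trans inf_le_right)
    cases i
    · exact le_sup_left
    · exact le_sup_right
  let σ₀ : ∀ i : Bool, (P.pushforward (puncture x hx).ι).Sec (S.basicOpen (cond i v₀ u₀)) :=
    fun i => (hP.nonempty_sec_of_isAffineOpen (hU₀.basicOpen _) (hle i)).some
  -- When the second generator is zero, the punctured neighbourhood is the single principal open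
  -- `D(u₀)`, over which a section exists; this contradicts nontriviality.
  obtain hv | hdim := hdim
  · have hv₀ : v₀ = 0 := germ_injective_of_isIntegral S x hxU₀ (by rw [hv, map_zero])
    have : U₀ ⊓ puncture x hx = S.basicOpen u₀ := by
      rw [hpunc, hv₀, Scheme.basicOpen_zero, sup_bot_eq]
    exact absurd (this ▸ ⟨σ₀ false⟩) (hnt' hxU₀)
  obtain ⟨n, hn⟩ := GaScheme.Sec.exists_pow_mul_eq_resFun (u₀ * v₀) (S.basicOpen_mul u₀ v₀).symm
    (inf_le_left.trans (S.basicOpen_le _))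
    (GaScheme.Sec.sub hQ ((σ₀ true).res inf_le_right) ((σ₀ false).res inf_le_left))
  -- The exponent is taken as `n + 1` because the syzygy lemma needs it nonzero, so that `u` divides
  -- `u ^ N`.
  obtain ⟨a, ha⟩ := hn (n + 1) n.le_succ
  generalize hN : n + 1 = N at ha
  obtain ⟨b₁, y₁, z₁, b₂, y₂, z₂, e₁, e₂, ey, ez⟩ := IsLocalRing.exists_syzygies_minor_eq hm
    (IsLocalRing.ne_zero_of_ringKrullDim_eq_two hm hdim)
    (IsLocalRing.dvd_of_dvd_mul_of_ringKrullDim_eq_two hm hdim)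
    (S.presheaf.germ U₀ x hxU₀ a) (N := N) (by omega)
  -- Potential inverses are spread out along with the syzygies, so that a germ `b₁` or `b₂`
  -- invertible at `x` is invertible on all of `U`, with no further shrinking.
  have hb : ∃ d₁ d₂, (IsUnit b₁ → b₁ * d₁ = 1) ∧ (IsUnit b₂ → b₂ * d₂ = 1) := by
    refine ⟨Ring.inverse b₁, Ring.inverse b₂, Ring.mul_inverse_cancel _, Ring.mul_inverse_cancel _⟩
  obtain ⟨d₁, d₂, hd₁, hd₂⟩ := hb
  obtain ⟨U, hxU, hU, hUU₀, hlift⟩ := exists_isAffineOpen_germ_eq x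
    (F := {b₁, y₁, z₁, b₂, y₂, z₂, d₁, d₂}) (Set.toFinite _) U₀ hxU₀
  have hinj := germ_injective_of_isIntegral S x hxU
  obtain ⟨b₁, rfl⟩ := hlift b₁ (by simp)
  obtain ⟨y₁, rfl⟩ := hlift y₁ (by simp)
  obtain ⟨z₁, rfl⟩ := hlift z₁ (by simp)
  obtain ⟨b₂, rfl⟩ := hlift b₂ (by simp)
  obtain ⟨y₂, rfl⟩ := hlift y₂ (by simp)
  obtain ⟨z₂, rfl⟩ := hlift z₂ (by simp)
  obtain ⟨d₁, rfl⟩ := hlift d₁ (by simp)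
  obtain ⟨d₂, rfl⟩ := hlift d₂ (by simp)
  let f : Bool → Γ(S, U) := fun i => resFun hUU₀ (cond i v₀ u₀)
  have hf : ∀ i, S.basicOpen (f i) = U ⊓ S.basicOpen (cond i v₀ u₀) :=
    fun i => basicOpen_resFun _ _
  have hfle : ∀ i, S.basicOpen (f i) ≤ S.basicOpen (cond i v₀ u₀) :=
    fun i => (hf i).le.trans inf_le_right
  let σ : ∀ i, (P.pushforward (puncture x hx).ι).Sec (S.basicOpen (f i)) :=
    fun i => (σ₀ i).res (hfle i)
  have hpuncU : ⨆ i, S.basicOpen (f i) = U ⊓ puncture x hx := by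
    rw [iSup_bool_eq, hf, hf, ← inf_sup_left, sup_comm]
    change U ⊓ (S.basicOpen u₀ ⊔ S.basicOpen v₀) = _
    rw [← hpunc, ← inf_assoc, inf_eq_left.mpr hUU₀]
  have hsub : ∀ (W : S.Opens) (hi : W ≤ S.basicOpen (f false)) (hj : W ≤ S.basicOpen (f true)),
      resFun (hi.trans (S.basicOpen_le _)) (f false * f true) ^ N *
        GaScheme.Sec.sub hQ ((σ true).res hj) ((σ false).res hi) =
          resFun (hi.trans (S.basicOpen_le _)) (resFun hUU₀ a) := by
    intro W hi hj
    have hW : W ≤ S.basicOpen u₀ ⊓ S.basicOpen v₀ :=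
      le_inf (hi.trans (hfle false)) (hj.trans (hfle true))
    have := congrArg (resFun hW) ha
    rw [map_mul, map_pow, resFun_resFun, resFun_resFun, GaScheme.Sec.res_sub, GaScheme.Sec.res_res,
      GaScheme.Sec.res_res] at this
    rw [resFun_resFun, this, GaScheme.Sec.res_res, GaScheme.Sec.res_res, ← map_mul, resFun_resFun]
    rfl
  simp only [← germ_resFun hUU₀ x hxU] at e₁ e₂ ey ez
  simp only [← map_mul, ← map_pow, ← map_add, ← map_sub] at e₁ e₂ ey ez
  replace e₁ := hinj e₁
  replace e₂ := hinj e₂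
  replace ey := hinj ey
  replace ez := hinj ez
  rw [map_pow, map_pow] at e₁ e₂
  rw [map_pow] at ey ez
  obtain ⟨y, hy, hyt⟩ :=
    GaScheme.Sec.exists_isTwisted hQ σ (b := b₁) (fun i => cond i z₁ y₁) e₁ hsub
  obtain ⟨z, hz, hzt⟩ :=
    GaScheme.Sec.exists_isTwisted hQ σ (b := b₂) (fun i => cond i z₂ y₂) e₂ hsub
  -- The minors of the syzygies are `u ^ N` and `v ^ N`, exactly the denominators of the coordinates
  -- on the two charts, so both determinants are one.
  have hyz : ∀ i, resFun (S.basicOpen_le (f i)) b₁ * z i -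
      resFun (S.basicOpen_le (f i)) b₂ * y i = 1 := by
    intro i
    apply ((isUnit_resFun_basicOpen (f i)).pow N).mul_left_cancel
    have : b₁ * cond i z₂ y₂ - b₂ * cond i z₁ y₁ = f i ^ N := by
      cases i
      · exact ey
      · exact ez
    have := congrArg (resFun (S.basicOpen_le (f i))) this
    rw [map_sub, map_mul, map_mul, map_pow] at this
    linear_combination this + resFun (S.basicOpen_le (f i)) b₁ * hz i -
      resFun (S.basicOpen_le (f i)) b₂ * hy i
  -- Otherwise the extension splits over `U` minus `x`, against nontriviality.
  have hb₁ : ¬ IsUnit (S.presheaf.germ U x hxU b₁) := by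
    intro h
    have : b₁ * d₁ = 1 := hinj (by rw [map_mul, hd₁ h, map_one])
    exact hnt' hxU (hpuncU ▸ hyt.nonempty_sec hQ (IsUnit.of_mul_eq_one _ this))
  have hb₂ : ¬ IsUnit (S.presheaf.germ U x hxU b₂) := by
    intro h
    have : b₂ * d₂ = 1 := hinj (by rw [map_mul, hd₂ h, map_one])
    exact hnt' hxU (hpuncU ▸ hzt.nonempty_sec hQ (IsUnit.of_mul_eq_one _ this))
  have hgh : IsOnlyCommonZero b₁ b₂ x := by
    rw [IsOnlyCommonZero, Scheme.zeroLocus_def]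
    ext q
    simp only [Set.mem_inter_iff, Set.mem_insert_iff, Set.mem_singleton_iff, Set.mem_iInter]
    refine ⟨?_, ?_⟩
    · rintro ⟨hq, hq'⟩
      by_contra hqx
      obtain ⟨i, hi⟩ := TopologicalSpace.Opens.mem_iSup.mp
        (hpuncU.ge (show q ∈ U ⊓ puncture x hx from ⟨hq, hqx⟩))
      have h₁ : ∀ b : Γ(S, U), q ∉ S.basicOpen b →
          S.presheaf.germ _ q hi (resFun (S.basicOpen_le (f i)) b) ∈
            IsLocalRing.maximalIdeal (S.presheaf.stalk q) := by
        intro b hb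
        rw [germ_resFun, IsLocalRing.mem_maximalIdeal, mem_nonunits_iff, ← Scheme.mem_basicOpen]
        exact hb
      have h₂ := congrArg (S.presheaf.germ _ q hi) (hyz i)
      rw [map_sub, map_mul, map_mul, map_one] at h₂
      refine (Ideal.ne_top_iff_one _).mp
        (IsLocalRing.maximalIdeal.isMaximal (S.presheaf.stalk q)).ne_top ?_
      rw [← h₂]
      exact Ideal.sub_mem _ (Ideal.mul_mem_right _ _ (h₁ _ (hq' _ (Or.inl rfl))))
        (Ideal.mul_mem_right _ _ (h₁ _ (hq' _ (Or.inr rfl))))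
    · rintro rfl
      refine ⟨hxU, ?_⟩
      rintro b (rfl | rfl) h
      · exact hb₁ ((Scheme.mem_basicOpen _ _ _ hxU).mp h)
      · exact hb₂ ((Scheme.mem_basicOpen _ _ _ hxU).mp h)
  exact ⟨U, b₁, b₂, hgh, hxU, hU, GaScheme.nonempty_iso_puncturedMap s hP.isTorsor b₁ b₂ hgh
    (fun i => S.basicOpen (f i)) (fun i => (le_iSup (fun i => S.basicOpen (f i)) i).trans hpuncU.le)
    hpuncU.ge σ y z hyz hyt hzt⟩
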